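/- Let $\mathfrak h$ be a separable complex Hilbert space, with inner product linear in the second argument, and let $J$ be an antilinear map of $\mathfrak h$ with $J^2=1$ and $\langle J\phi, J\psi\rangle=\langle\psi,\phi\rangle$. Let $\mathfrak F_A=\mathfrak F_B=\bigoplus_{n\ge 0}\mathfrak h^{\otimes_{\rm symm} n}$ be two copies of the Bose Fock space over $\mathfrak h$ (a Hilbert space direct sum), with vacuum vectors $\Omega_A,\Omega_B$. Let $A(\phi),B(\phi)$ be the closed annihilation operators (antilinear in $\phi$) on $\mathfrak F_A,\mathfrak F_B$, given on their natural domains by $(A(\phi)f)_n=\sqrt{n+1}\,\langle\phi|f_{n+1}$, where $\langle\phi|$ contracts the first tensor factor with $\phi$; let $A(\phi)^*,B(\phi)^*$ be their adjoints, the creation operators. Let $\mathcal D\subset\mathfrak F_A$ be the dense subspace of finite-particle vectors. On the Hilbert space $\mathfrak F_A\otimes\mathfrak F_B$ let $$Z(\phi)=A(\phi)\otimes I_B+I_A\otimes B(J\phi)^*\qquad(\phi\in\mathfrak h),$$ meaning the closure of the sum of the two algebraic tensor product operators, and let $Z(\phi)^*$ be its adjoint. Products of unbounded operators have their natural domains,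 and a (possibly infinite) linear combination of operators has as its domain the set of vectors that lie in the domain of every operator with a non-zero coefficient and at which the sum converges unconditionally. For a (possibly unbounded) operator $X$ on $\mathfrak F_A\otimes\mathfrak F_B$, the partial vacuum expectation $\mathcal E_A(X)$ is the operator on $\mathfrak F_A$ with domain $\{v: v\otimes\Omega_B\in\operatorname{dom}X\}$ determined by $$\langle u,\mathcal E_A(X)v\rangle=\langle u\otimes\Omega_B, X(v\otimes\Omega_B)\rangle\qquad(u\in\mathfrak F_A).$$ Then the following hold. 1. (Monomials.) For all $n,m\ge0$ and $\phi_1,\dots,\phi_n,\psi_1,\dots,\psi_m\in\mathfrak h$, $$\mathcal E_A\bigl(Z(\phi_1)\cdots Z(\phi_n)Z(\psi_1)^*\cdots Z(\psi_m)^*\bigr)\subseteq A(\phi_1)\cdots A(\phi_n)A(\psi_1)^*\cdots A(\psi_m)^*,$$ that is, the two sides agree on the domain of the left side, which is contained in that of the right side; and the domain of the left side contains $\mathcal D$. 2. (Independence of the order of the commuting fields.) If $X$ is a product, in any order, of finitely many operators of the form $Z(\phi)$ and $Z(\psi)^*$, with $\phi_1,\dots,\phi_n$ the arguments of the factors $Z(\cdot)$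 and $\psi_1,\dots,\psi_m$ those of the factors $Z(\cdot)^*$, each in order of appearance, then $\mathcal D$ is contained in the domains of $\mathcal E_A(X)$ and of $A(\phi_1)\cdots A(\phi_n)A(\psi_1)^*\cdots A(\psi_m)^*$, and these two operators agree on $\mathcal D$. 3. (Functions.) For a polynomial or formal power series $$f=\sum c_{\phi_1,\dots,\phi_n;\,\psi_1,\dots,\psi_m}\;\alpha(\phi_1)\cdots\alpha(\phi_n)\,\alpha(\psi_1)^*\cdots\alpha(\psi_m)^*$$ in commuting variables $\alpha(\phi),\alpha(\phi)^*$, let $\varphi(f)=f(Z,Z^*)$ be obtained by replacing $\alpha(\cdot)$ and $\alpha(\cdot)^*$ by $Z(\cdot)$ and $Z(\cdot)^*$ in each term, and let the anti-Wick quantization be $$\mathscr A(f)=\sum c_{\phi_1,\dots,\phi_n;\,\psi_1,\dots,\psi_m}\;A(\phi_1)\cdots A(\phi_n)\,A(\psi_1)^*\cdots A(\psi_m)^*.$$ Then $\mathcal E_A(\varphi(f))\subseteq\mathscr A(f)$. The domain of $\mathcal E_A(\varphi(f))$ contains $\mathcal D$ if $f$ is a polynomial, and also if $f$ is one of the exponential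 functions $$e^{\alpha(\phi)^*-\alpha(\phi)}=\sum_{n,m\ge0}\frac{(-1)^n}{n!\,m!}\,\alpha(\phi)^n(\alpha(\phi)^*)^m\qquad(\phi\in\mathfrak h).$$ So $\mathcal E_A\circ\varphi=\mathscr A$ on $\mathcal D$ for these functions. -/

import Mathlib

open scoped TensorProduct InnerProductSpace ComplexConjugate

noncomputable section

namespace BoseFock

universe u

section OneParticle

variable (h : Type u) [NormedAddCommGroup h] [InnerProductSpace ℂ h]

/-! ### Tensor powers with their Hilbert space inner product -/

/-- The algebraic `n`-fold tensor power `h ⊗ ⋯ ⊗ h`, as a type of its own, since it will carry the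
Hilbert space norm and not the projective one. -/
def TPow (n : ℕ) : Type u := ⨂[ℂ]^n h

instance instAddCommGroupTPow (n : ℕ) : AddCommGroup (TPow h n) :=
  inferInstanceAs (AddCommGroup (⨂[ℂ]^n h))

instance instModuleTPow (n : ℕ) : Module ℂ (TPow h n) :=
  inferInstanceAs (Module ℂ (⨂[ℂ]^n h))

/-- The elementary tensor `x 0 ⊗ ⋯ ⊗ x (n - 1)`. -/
def tprod (n : ℕ) (x : Fin n → h) : TPow h n := PiTensorProduct.tprod ℂ x

/-- Scalars as `0`-fold tensors. -/
def zeroEquiv : TPow h 0 ≃ₗ[ℂ] ℂ := PiTensorProduct.isEmptyEquiv (Fin 0)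

/-- Splitting off the first factor: `x 0 ⊗ ⋯ ⊗ x n ↦ x 0 ⊗ (x 1 ⊗ ⋯ ⊗ x n)`. -/
def splitAux (n : ℕ) : (⨂[ℂ]^(n + 1) h) ≃ₗ[ℂ] h ⊗[ℂ] (⨂[ℂ]^n h) :=
  (PiTensorProduct.reindex ℂ (fun _ => h)
      ((finCongr (Nat.add_comm n 1)).trans finSumFinEquiv.symm)) ≪≫ₗ
    (PiTensorProduct.tmulEquiv ℂ h).symm ≪≫ₗ
    TensorProduct.congr (PiTensorProduct.subsingletonEquiv (0 : Fin 1)) (LinearEquiv.refl ℂ _)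

theorem splitAux_tprod (n : ℕ) (x : Fin (n + 1) → h) :
    splitAux h n (PiTensorProduct.tprod ℂ x) =
      x 0 ⊗ₜ[ℂ] PiTensorProduct.tprod ℂ (fun i => x i.succ) := by
  unfold splitAux
  rw [LinearEquiv.trans_apply, LinearEquiv.trans_apply, PiTensorProduct.reindex_tprod,
    PiTensorProduct.tmulEquiv_symm_apply, TensorProduct.congr_tmul,
    PiTensorProduct.subsingletonEquiv_apply_tprod, LinearEquiv.refl_apply]
  congr 2
  funext i
  congr 1
  ext
  simp

/-- The same map between the types `TPow`. -/
def splitEquiv (n : ℕ) : TPow h (n + 1) ≃ₗ[ℂ] h ⊗[ℂ] TPow h n := splitAux h n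

variable {h}

theorem zeroEquiv_tprod (x : Fin 0 → h) : zeroEquiv h (tprod h 0 x) = 1 := by
  exact PiTensorProduct.isEmptyEquiv_apply_tprod (Fin 0) x

theorem splitEquiv_tprod (n : ℕ) (x : Fin (n + 1) → h) :
    splitEquiv h n (tprod h (n + 1) x) = x 0 ⊗ₜ[ℂ] tprod h n (fun i => x i.succ) :=
  splitAux_tprod h n x

/-- Pulling an inner product back along an injective linear map. -/
@[reducible]
def coreOfInjective {E F : Type*} [AddCommGroup E] [Module ℂ E] [NormedAddCommGroup F]
    [InnerProductSpace ℂ F] (f : E →ₗ[ℂ] F) (hf : Function.Injective f) :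
    InnerProductSpace.Core ℂ E where
  inner x y := ⟪f x, f y⟫_ℂ
  conj_inner_symm x y := inner_conj_symm _ _
  re_inner_nonneg x := inner_self_nonneg
  add_left x y z := by simp
  smul_left x y r := by simp [mul_comm]
  definite x hx := hf (by simpa using hx)

variable (h)

/-- The inner product of `n`-fold tensors, by recursion through
`h ⊗ ⋯ ⊗ h = h ⊗ (h ⊗ ⋯ ⊗ h)`; see `inner_tprod` for its value on elementary tensors. -/
@[reducible]
def tpowCore : (n : ℕ) → InnerProductSpace.Core ℂ (TPow h n)
  | 0 => coreOfInjective (zeroEquiv h).toLinearMap (zeroEquiv h).injective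
  | n + 1 =>
    letI : NormedAddCommGroup (TPow h n) := (tpowCore n).toNormedAddCommGroup
    letI : InnerProductSpace ℂ (TPow h n) := InnerProductSpace.ofCore (tpowCore n).toCore
    coreOfInjective (splitEquiv h n).toLinearMap (splitEquiv h n).injective

instance instNormedTPow (n : ℕ) : NormedAddCommGroup (TPow h n) :=
  (tpowCore h n).toNormedAddCommGroup

instance instInnerTPow (n : ℕ) : InnerProductSpace ℂ (TPow h n) :=
  InnerProductSpace.ofCore (tpowCore h n).toCore

variable {h}

theorem inner_zero_def (s t : TPow h 0) : ⟪s, t⟫_ℂ = ⟪zeroEquiv h s, zeroEquiv h t⟫_ℂ := rfl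

theorem inner_succ_def (n : ℕ) (s t : TPow h (n + 1)) :
    ⟪s, t⟫_ℂ = ⟪splitEquiv h n s, splitEquiv h n t⟫_ℂ := rfl

theorem inner_tprod (n : ℕ) (x y : Fin n → h) :
    ⟪tprod h n x, tprod h n y⟫_ℂ = ∏ i, ⟪x i, y i⟫_ℂ := by
  induction n with
  | zero => simp [inner_zero_def, zeroEquiv_tprod]
  | succ n ih =>
    rw [inner_succ_def, splitEquiv_tprod, splitEquiv_tprod, TensorProduct.inner_tmul, ih,
      Fin.prod_univ_succ]

theorem tpow_ext {M : Type*} [AddCommGroup M] [Module ℂ M] {n : ℕ} {f g : TPow h n →ₗ[ℂ] M}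
    (H : ∀ x, f (tprod h n x) = g (tprod h n x)) : f = g :=
  PiTensorProduct.ext (R := ℂ) (s := fun _ : Fin n => h) (φ₁ := f) (φ₂ := g)
    (MultilinearMap.ext H)

variable (h)

/-- `splitEquiv` as an isometry. -/
def splitIso (n : ℕ) : TPow h (n + 1) ≃ₗᵢ[ℂ] h ⊗[ℂ] TPow h n :=
  (splitEquiv h n).isometryOfInner fun s t => (inner_succ_def n s t).symm

/-- The action of permutations on tensors,
`x 0 ⊗ ⋯ ⊗ x (n - 1) ↦ x (σ⁻¹ 0) ⊗ ⋯ ⊗ x (σ⁻¹ (n - 1))`. -/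
def permute (n : ℕ) (σ : Equiv.Perm (Fin n)) : TPow h n ≃ₗ[ℂ] TPow h n :=
  PiTensorProduct.reindex ℂ (fun _ => h) σ

/-- The symmetric tensors in `h ⊗ ⋯ ⊗ h`. -/
def SymT (n : ℕ) : Submodule ℂ (TPow h n) where
  carrier := {t | ∀ σ : Equiv.Perm (Fin n), permute h n σ t = t}
  add_mem' hs ht σ := by rw [map_add, hs σ, ht σ]
  zero_mem' σ := map_zero _
  smul_mem' c t ht σ := by rw [map_smul, ht σ]

variable {h}

theorem permute_tprod (n : ℕ) (σ : Equiv.Perm (Fin n)) (x : Fin n → h) :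
    permute h n σ (tprod h n x) = tprod h n (fun i => x (σ.symm i)) :=
  PiTensorProduct.reindex_tprod (R := ℂ) (s := fun _ : Fin n => h) σ x

/-- Contraction of the first factor with `φ`:
`x 0 ⊗ x 1 ⊗ ⋯ ⊗ x n ↦ ⟪φ, x 0⟫ • (x 1 ⊗ ⋯ ⊗ x n)`. -/
def contract (φ : h) (n : ℕ) : TPow h (n + 1) →L[ℂ] TPow h n :=
  (TensorProduct.lidIsometry ℂ (TPow h n)).toLinearIsometry.toContinuousLinearMap ∘L
    ((innerSL ℂ φ).rTensor (TPow h n)) ∘L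
      (splitIso h n).toLinearIsometry.toContinuousLinearMap

theorem contract_tprod (φ : h) (n : ℕ) (x : Fin (n + 1) → h) :
    contract φ n (tprod h (n + 1) x) = ⟪φ, x 0⟫_ℂ • tprod h n (fun i => x i.succ) := by
  change TensorProduct.lid ℂ (TPow h n)
    ((innerSL ℂ φ).rTensor (TPow h n) (splitEquiv h n (tprod h (n + 1) x))) = _
  rw [splitEquiv_tprod, ContinuousLinearMap.rTensor_tmul, TensorProduct.lid_tmul]
  rfl

theorem contract_permute (φ : h) (n : ℕ) (σ : Equiv.Perm (Fin n)) (t : TPow h (n + 1)) :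
    contract φ n (permute h (n + 1) (Equiv.Perm.decomposeFin.symm (0, σ)) t) =
      permute h n σ (contract φ n t) := by
  have key : (contract φ n).toLinearMap ∘ₗ
      (permute h (n + 1) (Equiv.Perm.decomposeFin.symm (0, σ))).toLinearMap =
      (permute h n σ).toLinearMap ∘ₗ (contract φ n).toLinearMap := by
    refine tpow_ext fun x => ?_
    have h0 : (Equiv.Perm.decomposeFin.symm (0, σ)).symm 0 = 0 := by
      rw [Equiv.symm_apply_eq]; simp
    have h1 : ∀ i : Fin n,
        (Equiv.Perm.decomposeFin.symm (0, σ)).symm i.succ = (σ.symm i).succ := by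
      intro i
      rw [Equiv.symm_apply_eq]; simp
    simp only [LinearMap.comp_apply, LinearEquiv.coe_coe, ContinuousLinearMap.coe_coe,
      permute_tprod, contract_tprod, map_smul, h0, h1]
  exact LinearMap.congr_fun key t

theorem contract_mem (φ : h) (n : ℕ) {t : TPow h (n + 1)} (ht : t ∈ SymT h (n + 1)) :
    contract φ n t ∈ SymT h n := fun σ => by
  rw [← contract_permute, ht]

/-- Contraction with `φ`, on symmetric tensors. -/
def symContract (φ : h) (n : ℕ) : SymT h (n + 1) →L[ℂ] SymT h n :=
  ((contract φ n).comp (SymT h (n + 1)).subtypeL).codRestrict (SymT h n)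
    fun t => contract_mem φ n t.2

/-! ### Bose Fock space -/

variable (h)

/-- The `n`-particle space: the Hilbert space completion of the symmetric `n`-fold tensors. -/
def Sector (n : ℕ) : Type u := UniformSpace.Completion (SymT h n)

instance instNormedSector (n : ℕ) : NormedAddCommGroup (Sector h n) :=
  inferInstanceAs (NormedAddCommGroup (UniformSpace.Completion (SymT h n)))

instance instInnerSector (n : ℕ) : InnerProductSpace ℂ (Sector h n) :=
  inferInstanceAs (InnerProductSpace ℂ (UniformSpace.Completion (SymT h n)))

instance instCompleteSector (n : ℕ) : CompleteSpace (Sector h n) :=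
  inferInstanceAs (CompleteSpace (UniformSpace.Completion (SymT h n)))

/-- The inclusion of the symmetric `n`-fold tensors into the `n`-particle space. -/
def toSector (n : ℕ) : SymT h n →ₗᵢ[ℂ] Sector h n :=
  (UniformSpace.Completion.toComplₗᵢ : SymT h n →ₗᵢ[ℂ] UniformSpace.Completion (SymT h n))

theorem denseRange_toSector (n : ℕ) : DenseRange (toSector h n) :=
  UniformSpace.Completion.denseRange_coe

/-- The Bose Fock space over `h`: the Hilbert space direct sum of the `n`-particle spaces. -/
def Fock : Type u := lp (fun n => Sector h n) 2

instance instNormedFock : NormedAddCommGroup (Fock h) :=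
  inferInstanceAs (NormedAddCommGroup (lp (fun n => Sector h n) 2))

instance instInnerFock : InnerProductSpace ℂ (Fock h) :=
  inferInstanceAs (InnerProductSpace ℂ (lp (fun n => Sector h n) 2))

instance instCompleteFock : CompleteSpace (Fock h) :=
  inferInstanceAs (CompleteSpace (lp (fun n => Sector h n) 2))

variable {h}

/-- The `n`-particle component of a vector of Fock space. -/
def comp (n : ℕ) : Fock h →ₗ[ℂ] Sector h n where
  toFun f := (show lp (fun n => Sector h n) 2 from f) n
  map_add' _ _ := rfl
  map_smul' _ _ := rfl

theorem fock_ext {f g : Fock h} (H : ∀ n, comp n f = comp n g) : f = g :=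
  lp.ext (funext H)

/-- The vector of Fock space with given square-summable components. -/
def Fock.mk (f : (n : ℕ) → Sector h n) (hf : Memℓp f 2) : Fock h :=
  (⟨f, hf⟩ : lp (fun n => Sector h n) 2)

theorem comp_mk (f : (n : ℕ) → Sector h n) (hf : Memℓp f 2) (n : ℕ) :
    comp n (Fock.mk f hf) = f n := rfl

theorem memℓp_comp (f : Fock h) : Memℓp (fun n => comp n f) 2 :=
  lp.memℓp (show lp (fun n => Sector h n) 2 from f)

theorem inner_fock (f g : Fock h) : ⟪f, g⟫_ℂ = ∑' n, ⟪comp n f, comp n g⟫_ℂ :=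
  lp.inner_eq_tsum (𝕜 := ℂ) (show lp (fun n => Sector h n) 2 from f)
    (show lp (fun n => Sector h n) 2 from g)

variable (h)

/-- The vacuum vector `1 ⊕ 0 ⊕ 0 ⊕ ⋯`. -/
def vacuum : Fock h :=
  (lp.single 2 0 (toSector h 0 ⟨tprod h 0 Fin.elim0, fun σ => by
    rw [permute_tprod]; congr 1⟩) : lp (fun n => Sector h n) 2)

/-- The finite-particle vectors. -/
def finiteParticle : Submodule ℂ (Fock h) where
  carrier := {f | ∃ N : ℕ, ∀ n, N ≤ n → comp n f = 0}
  add_mem' := by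
    rintro f g ⟨N, hN⟩ ⟨M, hM⟩
    refine ⟨max N M, fun n hn => ?_⟩
    rw [map_add, hN n (le_of_max_le_left hn), hM n (le_of_max_le_right hn), add_zero]
  zero_mem' := ⟨0, fun n _ => map_zero _⟩
  smul_mem' := by
    rintro c f ⟨N, hN⟩
    exact ⟨N, fun n hn => by rw [map_smul, hN n hn, smul_zero]⟩

variable {h}

/-- Contraction with `φ`, from the `n + 1`-particle space to the `n`-particle space. -/
def sectorContract (φ : h) (n : ℕ) : Sector h (n + 1) →L[ℂ] Sector h n :=
  ((symContract φ n).completion :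
    UniformSpace.Completion (SymT h (n + 1)) →L[ℂ] UniformSpace.Completion (SymT h n))

theorem sectorContract_toSector (φ : h) (n : ℕ) (t : SymT h (n + 1)) :
    sectorContract φ n (toSector h (n + 1) t) = toSector h n (symContract φ n t) :=
  UniformSpace.Completion.map_coe (symContract φ n).uniformContinuous t

/-- The components `√(n + 1) ⟨φ| f (n + 1)` of the annihilation operator applied to `f`. -/
def annihilationComp (φ : h) (n : ℕ) : Fock h →ₗ[ℂ] Sector h n :=
  (Real.sqrt (n + 1) : ℂ) • ((sectorContract φ n).toLinearMap ∘ₗ comp (n + 1))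

/-- The annihilation operator `A(φ)`, antilinear in `φ`: the closed operator
`(A(φ) f) n = √(n + 1) ⟨φ| f (n + 1)` on its natural domain. -/
def annihilation (φ : h) : Fock h →ₗ.[ℂ] Fock h where
  domain :=
    { carrier := {f | Memℓp (fun n => annihilationComp φ n f) 2}
      add_mem' := fun {f g} hf hg => by
        change Memℓp (fun n => annihilationComp φ n (f + g)) 2
        simp only [map_add]
        exact Memℓp.add hf hg
      zero_mem' := by
        change Memℓp (fun n => annihilationComp φ n 0) 2
        simp only [map_zero]
        exact zero_memℓp
      smul_mem' := fun c {f} hf => by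
        change Memℓp (fun n => annihilationComp φ n (c • f)) 2
        simp only [map_smul]
        exact Memℓp.const_smul hf c }
  toFun :=
    { toFun := fun f => Fock.mk (fun n => annihilationComp φ n f) f.2
      map_add' := fun f g => fock_ext fun n => by
        rw [map_add]
        exact map_add (annihilationComp φ n) (f : Fock h) g
      map_smul' := fun c f => fock_ext fun n => by
        rw [map_smul]
        exact map_smul (annihilationComp φ n) c (f : Fock h) }

/-- The creation operator: the Hilbert space adjoint of the annihilation operator. -/
def creation (φ : h) : Fock h →ₗ.[ℂ] Fock h := (annihilation φ).adjoint

end OneParticle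

/-! ### Unbounded operators -/

section Operators

variable {E F G : Type*} [NormedAddCommGroup E] [InnerProductSpace ℂ E]
  [NormedAddCommGroup F] [InnerProductSpace ℂ F] [NormedAddCommGroup G] [InnerProductSpace ℂ G]

/-- The identity operator, defined everywhere. -/
def opId (E : Type*) [NormedAddCommGroup E] [InnerProductSpace ℂ E] : E →ₗ.[ℂ] E :=
  LinearMap.id.toPMap ⊤

/-- The product `S T` on its natural domain `{x ∈ dom T | T x ∈ dom S}`. -/
def opComp (S : F →ₗ.[ℂ] G) (T : E →ₗ.[ℂ] F) : E →ₗ.[ℂ] G where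
  domain := (S.domain.comap T.toFun).map T.domain.subtype
  toFun :=
    { toFun := fun x => S ⟨T ⟨x, by obtain ⟨y, -, hy⟩ := x.2; exact hy ▸ y.2⟩, by
        obtain ⟨x, y, hy, rfl⟩ := x; exact hy⟩
      map_add' := fun x y => by
        rw [← LinearPMap.map_add]
        congr 1
        exact Subtype.ext (LinearPMap.map_add T ⟨x, _⟩ ⟨y, _⟩)
      map_smul' := fun c x => by
        rw [RingHom.id_apply, ← LinearPMap.map_smul]
        congr 1
        exact Subtype.ext (LinearPMap.map_smul T c ⟨x, _⟩) }

theorem mem_opComp_domain (S : F →ₗ.[ℂ] G) (T : E →ₗ.[ℂ] F) (x : E) :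
    x ∈ (opComp S T).domain ↔ ∃ hx : x ∈ T.domain, T ⟨x, hx⟩ ∈ S.domain := by
  constructor
  · rintro ⟨y, hy, rfl⟩
    exact ⟨y.2, hy⟩
  · rintro ⟨hx, hy⟩
    exact ⟨⟨x, hx⟩, hy, rfl⟩

theorem opComp_apply (S : F →ₗ.[ℂ] G) (T : E →ₗ.[ℂ] F) (x : E) (hx : x ∈ T.domain)
    (hy : T ⟨x, hx⟩ ∈ S.domain) (hxy : x ∈ (opComp S T).domain) :
    opComp S T ⟨x, hxy⟩ = S ⟨T ⟨x, hx⟩, hy⟩ := rfl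

/-- The product `T₁ T₂ ⋯ Tₙ` of a list of operators, the empty product being the identity. -/
def opProd (L : List (E →ₗ.[ℂ] E)) : E →ₗ.[ℂ] E := L.foldr opComp (opId E)

variable (E F) in
/-- The Hilbert space tensor product. -/
def HTensor : Type _ := UniformSpace.Completion (E ⊗[ℂ] F)

instance instNormedHTensor : NormedAddCommGroup (HTensor E F) :=
  inferInstanceAs (NormedAddCommGroup (UniformSpace.Completion (E ⊗[ℂ] F)))

instance instInnerHTensor : InnerProductSpace ℂ (HTensor E F) :=
  inferInstanceAs (InnerProductSpace ℂ (UniformSpace.Completion (E ⊗[ℂ] F)))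

instance instCompleteHTensor : CompleteSpace (HTensor E F) :=
  inferInstanceAs (CompleteSpace (UniformSpace.Completion (E ⊗[ℂ] F)))

variable (E F) in
/-- The inclusion of the algebraic into the Hilbert space tensor product. -/
def toHTensor : (E ⊗[ℂ] F) →ₗᵢ[ℂ] HTensor E F :=
  (UniformSpace.Completion.toComplₗᵢ : (E ⊗[ℂ] F) →ₗᵢ[ℂ] UniformSpace.Completion (E ⊗[ℂ] F))

/-- The vector `x ⊗ y` of the Hilbert space tensor product. -/
def htmul (x : E) (y : F) : HTensor E F := toHTensor E F (x ⊗ₜ[ℂ] y)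

theorem denseRange_toHTensor : DenseRange (toHTensor E F) :=
  UniformSpace.Completion.denseRange_coe

/-- The inclusion of `dom S ⊗ dom T` (algebraic tensor product) into the Hilbert space tensor
product. -/
def domIncl (S : E →ₗ.[ℂ] E) (T : F →ₗ.[ℂ] F) :
    (S.domain ⊗[ℂ] T.domain) →ₗ[ℂ] HTensor E F :=
  (toHTensor E F).toLinearMap ∘ₗ TensorProduct.map S.domain.subtype T.domain.subtype

theorem domIncl_injective (S : E →ₗ.[ℂ] E) (T : F →ₗ.[ℂ] F) :
    Function.Injective (domIncl S T) :=
  (toHTensor E F).injective.comp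
    (TensorProduct.map_injective_of_flat_flat _ _ S.domain.injective_subtype
      T.domain.injective_subtype)

/-- The algebraic action `x ⊗ y ↦ S x ⊗ T y` on `dom S ⊗ dom T`. -/
def domMap (S : E →ₗ.[ℂ] E) (T : F →ₗ.[ℂ] F) :
    (S.domain ⊗[ℂ] T.domain) →ₗ[ℂ] HTensor E F :=
  (toHTensor E F).toLinearMap ∘ₗ TensorProduct.map S.toFun T.toFun

/-- The operator `S ⊗ T` with the algebraic tensor product of `dom S` and `dom T` as its domain. -/
def opTensor (S : E →ₗ.[ℂ] E) (T : F →ₗ.[ℂ] F) : HTensor E F →ₗ.[ℂ] HTensor E F where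
  domain := LinearMap.range (domIncl S T)
  toFun := domMap S T ∘ₗ
    (LinearEquiv.ofInjective (domIncl S T) (domIncl_injective S T)).symm.toLinearMap

theorem opTensor_apply (S : E →ₗ.[ℂ] E) (T : F →ₗ.[ℂ] F) (t : S.domain ⊗[ℂ] T.domain) :
    opTensor S T ⟨domIncl S T t, ⟨t, rfl⟩⟩ = domMap S T t := by
  have : (LinearEquiv.ofInjective (domIncl S T) (domIncl_injective S T)).symm
      ⟨domIncl S T t, ⟨t, rfl⟩⟩ = t := by
    rw [LinearEquiv.symm_apply_eq]
    rfl
  exact congrArg (domMap S T) this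

theorem htmul_mem_opTensor (S : E →ₗ.[ℂ] E) (T : F →ₗ.[ℂ] F) (x : S.domain) (y : T.domain) :
    htmul (x : E) (y : F) ∈ (opTensor S T).domain :=
  ⟨x ⊗ₜ[ℂ] y, rfl⟩

theorem opTensor_htmul (S : E →ₗ.[ℂ] E) (T : F →ₗ.[ℂ] F) (x : S.domain) (y : T.domain) :
    opTensor S T ⟨htmul (x : E) (y : F), htmul_mem_opTensor S T x y⟩ = htmul (S x) (T y) :=
  opTensor_apply S T (x ⊗ₜ[ℂ] y)

/-- The isometry `v ↦ v ⊗ y` of the Hilbert space tensor product, as a bounded operator. -/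
def tensorRight (E : Type*) [NormedAddCommGroup E] [InnerProductSpace ℂ E] (y : F) :
    E →L[ℂ] HTensor E F :=
  (toHTensor E F).toContinuousLinearMap ∘L (TensorProduct.mkL ℂ E F).flip y

theorem tensorRight_apply (x : E) (y : F) : tensorRight E y x = htmul x y := rfl

/-- The extension by `0` of an operator from its domain to the whole space. -/
def opExt (T : E →ₗ.[ℂ] F) (x : E) : F :=
  open Classical in if hx : x ∈ T.domain then T ⟨x, hx⟩ else 0

theorem opExt_of_mem (T : E →ₗ.[ℂ] F) {x : E} (hx : x ∈ T.domain) : opExt T x = T ⟨x, hx⟩ :=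
  dif_pos hx

theorem opExt_add (T : E →ₗ.[ℂ] F) {x y : E} (hx : x ∈ T.domain) (hy : y ∈ T.domain) :
    opExt T (x + y) = opExt T x + opExt T y := by
  rw [opExt_of_mem T hx, opExt_of_mem T hy, opExt_of_mem T (T.domain.add_mem hx hy)]
  exact LinearPMap.map_add T ⟨x, hx⟩ ⟨y, hy⟩

theorem opExt_smul (T : E →ₗ.[ℂ] F) (a : ℂ) {x : E} (hx : x ∈ T.domain) :
    opExt T (a • x) = a • opExt T x := by
  rw [opExt_of_mem T hx, opExt_of_mem T (T.domain.smul_mem a hx)]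
  exact LinearPMap.map_smul T a ⟨x, hx⟩

/-- The natural domain of the (possibly infinite) linear combination `∑ c i • T i`: all `x` in
the domains of all `T i` with `c i ≠ 0` for which `∑ c i • T i x` converges unconditionally. -/
def opSeriesDomain {ι : Type*} (c : ι → ℂ) (T : ι → (E →ₗ.[ℂ] F)) : Submodule ℂ E where
  carrier := {x | (∀ i, c i ≠ 0 → x ∈ (T i).domain) ∧ Summable fun i => c i • opExt (T i) x}
  add_mem' := by
    rintro x y ⟨hx, hx'⟩ ⟨hy, hy'⟩
    refine ⟨fun i hi => (T i).domain.add_mem (hx i hi) (hy i hi), ?_⟩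
    refine (hx'.add hy').congr fun i => ?_
    by_cases hi : c i = 0
    · simp [hi]
    · rw [opExt_add (T i) (hx i hi) (hy i hi), smul_add]
  zero_mem' := by
    refine ⟨fun i _ => (T i).domain.zero_mem, ?_⟩
    refine (summable_zero : Summable fun _ : ι => (0 : F)).congr fun i => ?_
    rw [opExt_of_mem (T i) (T i).domain.zero_mem]
    exact ((congrArg (c i • ·) (LinearPMap.map_zero (T i))).trans (smul_zero _)).symm
  smul_mem' := by
    rintro a x ⟨hx, hx'⟩
    refine ⟨fun i hi => (T i).domain.smul_mem a (hx i hi), ?_⟩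
    refine (hx'.const_smul a).congr fun i => ?_
    by_cases hi : c i = 0
    · simp [hi]
    · rw [opExt_smul (T i) a (hx i hi), smul_comm]

/-- The (possibly infinite) linear combination `∑ c i • T i` on its natural domain. -/
def opSeries {ι : Type*} (c : ι → ℂ) (T : ι → (E →ₗ.[ℂ] F)) : E →ₗ.[ℂ] F where
  domain := opSeriesDomain c T
  toFun :=
    { toFun := fun x => ∑' i, c i • opExt (T i) x
      map_add' := fun x y => by
        rw [← x.2.2.tsum_add y.2.2]
        refine tsum_congr fun i => ?_
        by_cases hi : c i = 0
        · simp [hi]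
        · rw [← smul_add, ← opExt_add (T i) (x.2.1 i hi) (y.2.1 i hi)]
          rfl
      map_smul' := fun a x => by
        rw [RingHom.id_apply, ← x.2.2.tsum_const_smul a]
        refine tsum_congr fun i => ?_
        by_cases hi : c i = 0
        · simp [hi]
        · rw [smul_comm, ← opExt_smul (T i) a (x.2.1 i hi)]
          rfl }

end Operators

/-! ### The fields on the doubled Fock space, and the partial vacuum expectation -/

section Fields

variable {h : Type u} [NormedAddCommGroup h] [InnerProductSpace ℂ h]

/-- The field `Z(φ) = A(φ) ⊗ I + I ⊗ B(J φ)*` on `F_A ⊗ F_B`, both factors being the Fock space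
over `h`: the closure of the operator sum. -/
def zField (J : h →ₗ⋆[ℂ] h) (φ : h) :
    HTensor (Fock h) (Fock h) →ₗ.[ℂ] HTensor (Fock h) (Fock h) :=
  (opTensor (annihilation φ) (opId (Fock h)) +
    opTensor (opId (Fock h)) (creation (J φ))).closure

/-- Words in the fields have two kinds of letters: `.inl φ` for the field at `φ`, and `.inr ψ` for
the adjoint of the field at `ψ`. This is their reading as `A(φ)`, `A(ψ)*` on Fock space. -/
def aLetter : h ⊕ h → (Fock h →ₗ.[ℂ] Fock h)
  | .inl φ => annihilation φ
  | .inr ψ => (annihilation ψ).adjoint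

/-- The reading of the letters as the fields `Z(φ)`, `Z(ψ)*` on the doubled Fock space. -/
def zLetter (J : h →ₗ⋆[ℂ] h) :
    h ⊕ h → (HTensor (Fock h) (Fock h) →ₗ.[ℂ] HTensor (Fock h) (Fock h))
  | .inl φ => zField J φ
  | .inr ψ => (zField J ψ).adjoint

/-- The product of the fields `A(φ)`, `A(ψ)*` along a word. -/
def aWord (w : List (h ⊕ h)) : Fock h →ₗ.[ℂ] Fock h := opProd (w.map aLetter)

/-- The product of the fields `Z(φ)`, `Z(ψ)*` along a word. -/
def zWord (J : h →ₗ⋆[ℂ] h) (w : List (h ⊕ h)) :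
    HTensor (Fock h) (Fock h) →ₗ.[ℂ] HTensor (Fock h) (Fock h) := opProd (w.map (zLetter J))

/-- The word `φ₁ ⋯ φₙ ψ₁* ⋯ ψₘ*`. -/
def orderedWord (p : List h × List h) : List (h ⊕ h) := p.1.map .inl ++ p.2.map .inr

/-- The lists of the unstarred and of the starred letters of a word. -/
def sortWord (w : List (h ⊕ h)) : List h × List h :=
  (w.filterMap Sum.getLeft?, w.filterMap Sum.getRight?)

/-- The partial vacuum expectation over the second factor, `E_A(X) v = V* X V v` with
`V v = v ⊗ Ω`, for a possibly unbounded operator `X`; its domain consists of all `v` with `v ⊗ Ω`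
in the domain of `X`. See `inner_vacExp` for its matrix elements. -/
def vacExp (X : HTensor (Fock h) (Fock h) →ₗ.[ℂ] HTensor (Fock h) (Fock h)) :
    Fock h →ₗ.[ℂ] Fock h where
  domain := X.domain.comap (tensorRight (Fock h) (vacuum h)).toLinearMap
  toFun := (ContinuousLinearMap.adjoint (tensorRight (Fock h) (vacuum h))).toLinearMap ∘ₗ
    X.toFun ∘ₗ (tensorRight (Fock h) (vacuum h)).toLinearMap.restrict fun _ hv => hv

theorem mem_vacExp_domain (X : HTensor (Fock h) (Fock h) →ₗ.[ℂ] HTensor (Fock h) (Fock h))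
    (v : Fock h) : v ∈ (vacExp X).domain ↔ htmul v (vacuum h) ∈ X.domain := Iff.rfl

theorem inner_vacExp (X : HTensor (Fock h) (Fock h) →ₗ.[ℂ] HTensor (Fock h) (Fock h))
    (u v : Fock h) (hv : v ∈ (vacExp X).domain) :
    ⟪u, vacExp X ⟨v, hv⟩⟫_ℂ = ⟪htmul u (vacuum h), X ⟨htmul v (vacuum h), hv⟩⟫_ℂ :=
  ContinuousLinearMap.adjoint_inner_right (tensorRight (Fock h) (vacuum h)) u _

/-- For a function `f = ∑ c(φ, ψ) α(φ₁) ⋯ α(φₙ) α(ψ₁)* ⋯ α(ψₘ)*` of commuting variables, given by its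
coefficients, the same function `f(Z, Z*)` of the commuting fields `Z`. -/
def zFunction (J : h →ₗ⋆[ℂ] h) (c : List h × List h → ℂ) :
    HTensor (Fock h) (Fock h) →ₗ.[ℂ] HTensor (Fock h) (Fock h) :=
  opSeries c fun p => zWord J (orderedWord p)

/-- The anti-Wick quantization `∑ c(φ, ψ) A(φ₁) ⋯ A(φₙ) A(ψ₁)* ⋯ A(ψₘ)*` of
`f = ∑ c(φ, ψ) α(φ₁) ⋯ α(φₙ) α(ψ₁)* ⋯ α(ψₘ)*`. -/
def antiWick (c : List h × List h → ℂ) : Fock h →ₗ.[ℂ] Fock h :=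
  opSeries c fun p => aWord (orderedWord p)

/-- The coefficients of the function `exp (α(φ)* - α(φ)) = ∑ (-1)ⁿ / (n! m!) α(φ)ⁿ (α(φ)*)ᵐ`. -/
def expCoeff (φ : h) (p : List h × List h) : ℂ :=
  open Classical in
  if (∀ x ∈ p.1, x = φ) ∧ (∀ x ∈ p.2, x = φ) then
    (-1) ^ p.1.length / ((p.1.length.factorial : ℂ) * (p.2.length.factorial : ℂ))
  else 0

end Fields


end BoseFock
end

/-! Let `V v = v ⊗ Ω`, an isometry, so that `E_A(X) = V* X V`; the operator `V*` is `vacProj`. Two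
inclusions carry the theorem. On the right, `Z(ψ)* V ⊆ V A(ψ)*`, because `B(Jψ)` annihilates the
vacuum (`mem_graph_creation_of_htmul_vacuum`). On the left, `V* Z(φ) ⊆ A(φ) V*`, because the range
of `B(Jφ)*` is orthogonal to the vacuum (`vacProj_mem_graph_annihilation`). In an ordered word the
starred factors therefore pass through `V` and the others through `V*`, and `V* V = 1` is left. Both
inclusions hold on full natural domains: the first by testing the adjoint relation on vectors `a ⊗
b`, the second because `A(φ)` is closed.

All letters preserve the algebraic tensor product of finite-particle vectors, which gives the domain
statements. There `Z(φ)` and `Z(ψ)*` commute: the commutator `⟪φ, ψ⟫` of `A(φ)` with `A(ψ)*` cancels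
against `-⟪Jψ, Jφ⟫` from the second factor. Any word can thus be sorted
(`finWord_orderedWord_sortWord`). This rests on the canonical commutation relations, for which the
abstract adjoint `creation` must be identified with the sum of all insertions of a factor into a
symmetric tensor.

For functions, the bounded operator `V*` passes through unconditionally convergent sums. For the
exponentials, a word of length `l` applied to vectors with fewer than `K` particles per factor has
norm of order `C ^ l * √((K + l)!)` (`norm_finWord_le`), and the coefficients `1 / (n! m!)` with `l
= n + m` make this summable. -/

noncomputable section

namespace BoseFock

universe u

/-! ### Insertion of a factor as the adjoint of contraction. -/

section TensorPowers

variable {h : Type u} [NormedAddCommGroup h] [InnerProductSpace ℂ h]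

/-! ### Creation on symmetric tensors -/

/-- Prepending a factor: `x 0 ⊗ ⋯ ⊗ x (n - 1) ↦ ψ ⊗ x 0 ⊗ ⋯ ⊗ x (n - 1)`. -/
def prepend (ψ : h) (n : ℕ) : TPow h n →ₗ[ℂ] TPow h (n + 1) :=
  (splitEquiv h n).symm.toLinearMap ∘ₗ TensorProduct.mk ℂ h (TPow h n) ψ

theorem splitEquiv_prepend (ψ : h) (n : ℕ) (t : TPow h n) :
    splitEquiv h n (prepend ψ n t) = ψ ⊗ₜ[ℂ] t :=
  (splitEquiv h n).apply_symm_apply _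

theorem prepend_tprod (ψ : h) (n : ℕ) (x : Fin n → h) :
    prepend ψ n (tprod h n x) = tprod h (n + 1) (Fin.cons ψ x) := by
  apply (splitEquiv h n).injective
  rw [splitEquiv_prepend, splitEquiv_tprod]
  simp

/-- Inserting a factor at position `p`. -/
def insertT (ψ : h) (n : ℕ) (p : Fin (n + 1)) : TPow h n →ₗ[ℂ] TPow h (n + 1) :=
  (permute h (n + 1) p.cycleRange.symm).toLinearMap ∘ₗ prepend ψ n

/-- `p.cycleRange.symm` moves slot `0` to slot `p` and keeps the other slots in order. -/
theorem insertT_tprod (ψ : h) (n : ℕ) (p : Fin (n + 1)) (x : Fin n → h) :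
    insertT ψ n p (tprod h n x) = tprod h (n + 1) (p.insertNth (α := fun _ => h) ψ x) := by
  rw [insertT, LinearMap.comp_apply, prepend_tprod, LinearEquiv.coe_coe, permute_tprod,
    ← Fin.cons_comp_cycleRange]
  rfl

theorem contract_insertT_zero (φ ψ : h) (n : ℕ) (t : TPow h n) :
    contract φ n (insertT ψ n 0 t) = ⟪φ, ψ⟫_ℂ • t := by
  have key : (contract φ n).toLinearMap ∘ₗ insertT ψ n 0 = ⟪φ, ψ⟫_ℂ • LinearMap.id := by
    refine tpow_ext fun x => ?_
    simp [insertT_tprod, contract_tprod]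
  exact LinearMap.congr_fun key t

/-- The new factor sits behind the first one, so contraction still meets the old first factor, and
the position of the insertion drops by one. -/
theorem contract_insertT_succ (φ ψ : h) (n : ℕ) (p : Fin (n + 1)) (t : TPow h (n + 1)) :
    contract φ (n + 1) (insertT ψ (n + 1) p.succ t) = insertT ψ n p (contract φ n t) := by
  have key : (contract φ (n + 1)).toLinearMap ∘ₗ insertT ψ (n + 1) p.succ =
      insertT ψ n p ∘ₗ (contract φ n).toLinearMap := by
    refine tpow_ext fun x => ?_
    obtain ⟨a, y, rfl⟩ : ∃ a y, x = Fin.cons a y := ⟨x 0, Fin.tail x, (Fin.cons_self_tail x).symm⟩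
    simp [insertT_tprod, contract_tprod, Fin.insertNth_succ_cons]
  exact LinearMap.congr_fun key t

theorem permute_mul (n : ℕ) (σ τ : Equiv.Perm (Fin n)) (t : TPow h n) :
    permute h n (σ * τ) t = permute h n σ (permute h n τ t) := by
  have key : (permute h n (σ * τ)).toLinearMap =
      (permute h n σ).toLinearMap ∘ₗ (permute h n τ).toLinearMap := by
    refine tpow_ext fun x => ?_
    simp only [LinearMap.comp_apply, LinearEquiv.coe_coe, permute_tprod]
    rfl
  exact LinearMap.congr_fun key t

theorem permute_prepend (ψ : h) (n : ℕ) (σ : Equiv.Perm (Fin n)) (t : TPow h n) :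
    permute h (n + 1) (Equiv.Perm.decomposeFin.symm (0, σ)) (prepend ψ n t) =
      prepend ψ n (permute h n σ t) := by
  have key : (permute h (n + 1) (Equiv.Perm.decomposeFin.symm (0, σ))).toLinearMap ∘ₗ
      prepend ψ n = prepend ψ n ∘ₗ (permute h n σ).toLinearMap := by
    refine tpow_ext fun x => ?_
    simp only [LinearMap.comp_apply, LinearEquiv.coe_coe, permute_tprod, prepend_tprod]
    congr 1
    funext i
    refine Fin.cases ?_ (fun i => ?_) i
    · rw [show (Equiv.Perm.decomposeFin.symm (0, σ)).symm 0 = 0 by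
        rw [Equiv.symm_apply_eq]; simp]
      simp
    · rw [show (Equiv.Perm.decomposeFin.symm (0, σ)).symm i.succ = (σ.symm i).succ by
        rw [Equiv.symm_apply_eq]; simp]
      simp
  exact LinearMap.congr_fun key t

theorem permute_prepend_of_apply_zero (ψ : h) (n : ℕ) {t : TPow h n} (ht : t ∈ SymT h n)
    {σ : Equiv.Perm (Fin (n + 1))} (hσ : σ 0 = 0) :
    permute h (n + 1) σ (prepend ψ n t) = prepend ψ n t := by
  obtain ⟨⟨p, τ⟩, rfl⟩ := Equiv.Perm.decomposeFin.symm.surjective σ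
  obtain rfl : p = 0 := by simpa using hσ
  rw [permute_prepend, ht]

/-- `τ⁻¹ * σ` fixes slot `0` and so only permutes the factors of the symmetric tensor `t`: all that
matters is where the new factor goes. -/
theorem permute_prepend_congr (ψ : h) (n : ℕ) {t : TPow h n} (ht : t ∈ SymT h n)
    {σ τ : Equiv.Perm (Fin (n + 1))} (H : σ 0 = τ 0) :
    permute h (n + 1) σ (prepend ψ n t) = permute h (n + 1) τ (prepend ψ n t) := by
  have h0 : (τ⁻¹ * σ) 0 = 0 := by simp [H]
  conv_lhs => rw [← mul_inv_cancel_left τ σ, permute_mul, permute_prepend_of_apply_zero ψ n ht h0]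

/-- The sum of all insertions of a factor. -/
def insertSum (ψ : h) (n : ℕ) : TPow h n →ₗ[ℂ] TPow h (n + 1) := ∑ p, insertT ψ n p

theorem insertSum_apply (ψ : h) (n : ℕ) (t : TPow h n) :
    insertSum ψ n t = ∑ p, insertT ψ n p t := by
  simp [insertSum]

/-- On a symmetric tensor, `σ` turns the insertion at `p` into the insertion at `σ p`, so the sum is
merely reindexed. -/
theorem insertSum_mem (ψ : h) (n : ℕ) {t : TPow h n} (ht : t ∈ SymT h n) :
    insertSum ψ n t ∈ SymT h (n + 1) := fun σ => by
  rw [insertSum_apply, map_sum, ← Equiv.sum_comp σ fun p => insertT ψ n p t]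
  refine Finset.sum_congr rfl fun p _ => ?_
  change permute h (n + 1) σ (permute h (n + 1) _ _) = permute h (n + 1) _ _
  rw [← permute_mul]
  refine permute_prepend_congr ψ n ht ?_
  simp [Fin.cycleRange_symm_zero]

theorem contract_insertSum_zero (φ ψ : h) (t : TPow h 0) :
    contract φ 0 (insertSum ψ 0 t) = ⟪φ, ψ⟫_ℂ • t := by
  rw [insertSum_apply, Fin.sum_univ_one, contract_insertT_zero]

/-- The commutation relation before normalization: insertion in front yields the scalar term, and
the other insertions commute with contraction. -/
theorem contract_insertSum_succ (φ ψ : h) (n : ℕ) (t : TPow h (n + 1)) :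
    contract φ (n + 1) (insertSum ψ (n + 1) t) =
      ⟪φ, ψ⟫_ℂ • t + insertSum ψ n (contract φ n t) := by
  rw [insertSum_apply, Fin.sum_univ_succ, map_add, contract_insertT_zero, map_sum,
    insertSum_apply]
  simp only [contract_insertT_succ]

theorem span_tprod (n : ℕ) : Submodule.span ℂ (Set.range (tprod h n)) = ⊤ :=
  PiTensorProduct.span_tprod_eq_top

theorem inner_permute (n : ℕ) (σ : Equiv.Perm (Fin n)) (s t : TPow h n) :
    ⟪permute h n σ s, permute h n σ t⟫_ℂ = ⟪s, t⟫_ℂ := by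
  have hs : s ∈ Submodule.span ℂ (Set.range (tprod h n)) := span_tprod (h := h) n ▸ trivial
  have ht : t ∈ Submodule.span ℂ (Set.range (tprod h n)) := span_tprod (h := h) n ▸ trivial
  induction hs using Submodule.span_induction with
  | mem s hs =>
    obtain ⟨x, rfl⟩ := hs
    induction ht using Submodule.span_induction with
    | mem t ht =>
      obtain ⟨y, rfl⟩ := ht
      rw [permute_tprod, permute_tprod, inner_tprod, inner_tprod]
      exact Equiv.prod_comp σ.symm fun i => ⟪x i, y i⟫_ℂ
    | zero => simp
    | add t t' _ _ h1 h2 => simp only [map_add, inner_add_right, h1, h2]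
    | smul c t _ h1 => simp only [map_smul, inner_smul_right, h1]
  | zero => simp
  | add s s' _ _ h1 h2 => simp only [map_add, inner_add_left, h1, h2]
  | smul c s _ h1 => simp only [map_smul, inner_smul_left, h1]

theorem inner_prepend (ψ : h) (n : ℕ) (s : TPow h n) (t : TPow h (n + 1)) :
    ⟪prepend ψ n s, t⟫_ℂ = ⟪s, contract ψ n t⟫_ℂ := by
  have ht : t ∈ Submodule.span ℂ (Set.range (tprod h (n + 1))) :=
    span_tprod (h := h) (n + 1) ▸ trivial
  induction ht using Submodule.span_induction with
  | mem t ht =>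
    obtain ⟨y, rfl⟩ := ht
    rw [inner_succ_def, splitEquiv_prepend, splitEquiv_tprod, TensorProduct.inner_tmul,
      contract_tprod, inner_smul_right]
  | zero => simp
  | add t t' _ _ h1 h2 => simp only [map_add, inner_add_right, h1, h2]
  | smul c t _ h1 => simp only [map_smul, inner_smul_right, h1]

/-- Each insertion is a permuted prepending. Permutations are unitary and fix `t`, so all `n + 1`
terms agree. -/
theorem inner_insertSum (ψ : h) (n : ℕ) (s : TPow h n) {t : TPow h (n + 1)}
    (ht : t ∈ SymT h (n + 1)) :
    ⟪insertSum ψ n s, t⟫_ℂ = (n + 1) * ⟪s, contract ψ n t⟫_ℂ := by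
  have key : ∀ p, ⟪insertT ψ n p s, t⟫_ℂ = ⟪s, contract ψ n t⟫_ℂ := fun p => by
    conv_lhs => rw [← ht p.cycleRange.symm]
    exact (inner_permute _ _ _ _).trans (inner_prepend ψ n s t)
  rw [insertSum_apply, sum_inner, Finset.sum_congr rfl fun p _ => key p]
  simp

theorem norm_contract_le (φ : h) (n : ℕ) : ‖contract φ n‖ ≤ ‖φ‖ := by
  refine ContinuousLinearMap.opNorm_le_bound _ (norm_nonneg _) fun t => ?_
  have h1 : ‖contract φ n t‖ = ‖(innerSL ℂ φ).rTensor (TPow h n) (splitIso h n t)‖ :=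
    (TensorProduct.lidIsometry ℂ (TPow h n)).norm_map _
  rw [h1]
  refine (ContinuousLinearMap.le_opNorm _ _).trans ?_
  rw [LinearIsometryEquiv.norm_map]
  gcongr
  exact (ContinuousLinearMap.norm_rTensor_le _ _).trans (innerSL_apply_norm ℂ φ).le

/-! ### Creation on the particle sectors -/

theorem sector_induction {n : ℕ} {p : Sector h n → Prop} (hp : IsClosed {f | p f})
    (H : ∀ t : SymT h n, p (toSector h n t)) (f : Sector h n) : p f :=
  isClosed_property (denseRange_toSector h n) hp H f

theorem norm_sectorContract_le (φ : h) (n : ℕ) : ‖sectorContract φ n‖ ≤ ‖φ‖ := by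
  refine ContinuousLinearMap.opNorm_le_bound _ (norm_nonneg _) fun f => ?_
  refine sector_induction (p := fun f => ‖sectorContract φ n f‖ ≤ ‖φ‖ * ‖f‖) ?_ (fun t => ?_) f
  · exact isClosed_le (by fun_prop) (by fun_prop)
  · rw [sectorContract_toSector, LinearIsometry.norm_map, LinearIsometry.norm_map]
    exact (contract φ n).le_of_opNorm_le (norm_contract_le φ n) _

/-- The adjoint of the contraction, from the `n`-particle to the `n + 1`-particle space. -/
def sectorInsert (ψ : h) (n : ℕ) : Sector h n →L[ℂ] Sector h (n + 1) :=
  ContinuousLinearMap.adjoint (sectorContract ψ n)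

/-- This makes the abstract adjoint explicit: it is the average of the insertions. The factor `n +
1` stands on the left to avoid a division. -/
theorem sectorInsert_toSector (ψ : h) (n : ℕ) (s : SymT h n) :
    ((n : ℂ) + 1) • sectorInsert ψ n (toSector h n s) =
      toSector h (n + 1) ⟨insertSum ψ n s, insertSum_mem ψ n s.2⟩ := by
  refine ext_inner_right ℂ fun f => ?_
  refine sector_induction (p := fun f => ⟪((n : ℂ) + 1) • sectorInsert ψ n (toSector h n s), f⟫_ℂ =
    ⟪toSector h (n + 1) ⟨insertSum ψ n s, insertSum_mem ψ n s.2⟩, f⟫_ℂ) ?_ (fun t => ?_) f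
  · exact isClosed_eq (by fun_prop) (by fun_prop)
  · rw [inner_smul_left, sectorInsert, ContinuousLinearMap.adjoint_inner_left,
      sectorContract_toSector, LinearIsometry.inner_map_map, LinearIsometry.inner_map_map]
    simp only [map_add, Complex.conj_natCast, map_one]
    exact (inner_insertSum ψ n s t.2).symm

theorem sectorContract_sectorInsert_zero (φ ψ : h) (f : Sector h 0) :
    sectorContract φ 0 (sectorInsert ψ 0 f) = ⟪φ, ψ⟫_ℂ • f := by
  refine sector_induction
    (p := fun f => sectorContract φ 0 (sectorInsert ψ 0 f) = ⟪φ, ψ⟫_ℂ • f) ?_ (fun t => ?_) f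
  · exact isClosed_eq ((sectorContract φ 0).continuous.comp (sectorInsert ψ 0).continuous)
      (continuous_const_smul _)
  · have := sectorInsert_toSector ψ 0 t
    simp only [Nat.cast_zero, zero_add, one_smul] at this
    rw [this, sectorContract_toSector, ← map_smul]
    congr 1
    exact Subtype.ext (contract_insertSum_zero φ ψ t)

/-- The coefficients `n + 2` and `n + 1` are the numbers of insertions in degrees `n + 1` and `n`.
They are also the squares of the normalizing roots in the creation and annihilation operators. -/
theorem sectorContract_sectorInsert_succ (φ ψ : h) (n : ℕ) (f : Sector h (n + 1)) :
    ((n : ℂ) + 2) • sectorContract φ (n + 1) (sectorInsert ψ (n + 1) f) =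
      ⟪φ, ψ⟫_ℂ • f + ((n : ℂ) + 1) • sectorInsert ψ n (sectorContract φ n f) := by
  refine sector_induction (p := fun f =>
    ((n : ℂ) + 2) • sectorContract φ (n + 1) (sectorInsert ψ (n + 1) f) =
      ⟪φ, ψ⟫_ℂ • f + ((n : ℂ) + 1) • sectorInsert ψ n (sectorContract φ n f)) ?_ (fun t => ?_) f
  · have h1 : Continuous fun f => sectorContract φ (n + 1) (sectorInsert ψ (n + 1) f) :=
      (sectorContract φ (n + 1)).continuous.comp (sectorInsert ψ (n + 1)).continuous
    have h2 : Continuous fun f => sectorInsert ψ n (sectorContract φ n f) :=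
      (sectorInsert ψ n).continuous.comp (sectorContract φ n).continuous
    exact isClosed_eq (h1.fun_const_smul _) ((continuous_const_smul _).add (h2.fun_const_smul _))
  · have h1 := sectorInsert_toSector ψ (n + 1) t
    rw [show (((n + 1 : ℕ) : ℂ) + 1) = (n : ℂ) + 2 by push_cast; ring] at h1
    rw [← map_smul, h1, sectorContract_toSector, sectorContract_toSector, sectorInsert_toSector,
      ← map_smul, ← map_add]
    congr 1
    exact Subtype.ext (contract_insertSum_succ φ ψ n t)

end TensorPowers

/-! ### Particle-number cutoffs and the canonical commutation relations. -/

section FockSpace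

variable {h : Type u} [NormedAddCommGroup h] [InnerProductSpace ℂ h]

/-! ### Fock space: components and finite-particle vectors -/

theorem norm_comp_le (n : ℕ) (f : Fock h) : ‖comp n f‖ ≤ ‖f‖ :=
  lp.norm_apply_le_norm two_ne_zero (show lp (fun n => Sector h n) 2 from f) n

theorem hasSum_norm_comp_sq (f : Fock h) : HasSum (fun n => ‖comp n f‖ ^ 2) (‖f‖ ^ 2) := by
  have := lp.hasSum_norm (p := 2) (by norm_num) (show lp (fun n => Sector h n) 2 from f)
  simp only [ENNReal.toReal_ofNat, Real.rpow_ofNat] at this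
  exact this

/-- The `n`-particle component, as a bounded operator. -/
def compL (n : ℕ) : Fock h →L[ℂ] Sector h n :=
  (comp n).mkContinuous 1 fun f => by rw [one_mul]; exact norm_comp_le n f

theorem continuous_comp (n : ℕ) : Continuous (comp n : Fock h → Sector h n) :=
  (compL n).continuous

/-- The inclusion of the `n`-particle space into Fock space. -/
def ofSector (n : ℕ) : Sector h n →L[ℂ] Fock h :=
  lp.singleContinuousLinearMap ℂ (fun n => Sector h n) 2 n

theorem comp_ofSector_self (n : ℕ) (x : Sector h n) : comp n (ofSector n x) = x :=
  lp.single_apply_self 2 n x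

theorem comp_ofSector_ne {n m : ℕ} (hnm : m ≠ n) (x : Sector h n) :
    comp m (ofSector n x) = 0 :=
  lp.single_apply_ne 2 n x hnm

theorem inner_ofSector_left (n : ℕ) (x : Sector h n) (f : Fock h) :
    ⟪ofSector n x, f⟫_ℂ = ⟪x, comp n f⟫_ℂ :=
  lp.inner_single_left n x (show lp (fun n => Sector h n) 2 from f)

theorem inner_ofSector_right (n : ℕ) (x : Sector h n) (f : Fock h) :
    ⟪f, ofSector n x⟫_ℂ = ⟪comp n f, x⟫_ℂ :=
  lp.inner_single_right n x (show lp (fun n => Sector h n) 2 from f)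

theorem hasSum_ofSector (f : Fock h) : HasSum (fun n => ofSector n (comp n f)) f :=
  lp.hasSum_single (by norm_num) (show lp (fun n => Sector h n) 2 from f)

variable (h) in
/-- The vectors with fewer than `K` particles. -/
def fewParticles (K : ℕ) : Submodule ℂ (Fock h) where
  carrier := {f | ∀ n, K ≤ n → comp n f = 0}
  add_mem' hf hg n hn := by rw [map_add, hf n hn, hg n hn, add_zero]
  zero_mem' n _ := map_zero _
  smul_mem' c f hf n hn := by rw [map_smul, hf n hn, smul_zero]

theorem mem_finiteParticle {f : Fock h} : f ∈ finiteParticle h ↔ ∃ K, f ∈ fewParticles h K :=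
  Iff.rfl

theorem fewParticles_mono {K L : ℕ} (hKL : K ≤ L) : fewParticles h K ≤ fewParticles h L :=
  fun _ hf n hn => hf n (hKL.trans hn)

theorem fewParticles_le (K : ℕ) : fewParticles h K ≤ finiteParticle h := fun _ hf => ⟨K, hf⟩

theorem ofSector_mem (n : ℕ) (x : Sector h n) : ofSector n x ∈ fewParticles h (n + 1) :=
  fun _ hm => comp_ofSector_ne (by omega) x

theorem vacuum_mem : vacuum h ∈ fewParticles h 1 := ofSector_mem 0 _

theorem norm_vacuum : ‖vacuum h‖ = 1 := by
  refine (lp.norm_single (by norm_num) _ _).trans ?_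
  rw [LinearIsometry.norm_map]
  have : ⟪tprod h 0 Fin.elim0, tprod h 0 Fin.elim0⟫_ℂ = 1 := by rw [inner_tprod]; simp
  rw [inner_self_eq_norm_sq_to_K] at this
  have h2 : ‖tprod h 0 Fin.elim0‖ ^ 2 = 1 := Complex.ofReal_injective (by push_cast; exact this)
  exact (pow_eq_one_iff_of_nonneg (norm_nonneg _) two_ne_zero).mp h2

theorem dense_finiteParticle : Dense (finiteParticle h : Set (Fock h)) := fun f => by
  refine mem_closure_of_tendsto (hasSum_ofSector f) (Filter.Eventually.of_forall fun s => ?_)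
  exact Submodule.sum_mem _ fun n _ => fewParticles_le _ (ofSector_mem n _)

/-! ### Annihilation and creation with a cutoff in the particle number -/

theorem annihilationComp_apply (φ : h) (n : ℕ) (f : Fock h) :
    annihilationComp φ n f = (Real.sqrt (n + 1) : ℂ) • sectorContract φ n (comp (n + 1) f) := rfl

theorem continuous_annihilationComp (φ : h) (n : ℕ) :
    Continuous (annihilationComp φ n : Fock h → Sector h n) :=
  ((sectorContract φ n).continuous.comp (continuous_comp (n + 1))).const_smul _

/-- The annihilation operator, cut off to vectors with fewer than `K` particles. -/
def cutAnnihilation (φ : h) (K : ℕ) : Fock h →L[ℂ] Fock h :=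
  ∑ n ∈ Finset.range K,
    (Real.sqrt (n + 1) : ℂ) • (ofSector n ∘L sectorContract φ n ∘L compL (n + 1))

/-- The creation operator, cut off to vectors with fewer than `K` particles. -/
def cutCreation (ψ : h) (K : ℕ) : Fock h →L[ℂ] Fock h :=
  ∑ n ∈ Finset.range K,
    (Real.sqrt (n + 1) : ℂ) • (ofSector (n + 1) ∘L sectorInsert ψ n ∘L compL n)

theorem cutAnnihilation_apply (φ : h) (K : ℕ) (f : Fock h) :
    cutAnnihilation φ K f = ∑ n ∈ Finset.range K, ofSector n (annihilationComp φ n f) := by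
  simp only [cutAnnihilation, FunLike.coe_sum, Finset.sum_apply, FunLike.coe_smul, Pi.smul_apply,
    annihilationComp_apply, map_smul]
  rfl

theorem cutCreation_apply (ψ : h) (K : ℕ) (f : Fock h) :
    cutCreation ψ K f = ∑ n ∈ Finset.range K,
      ofSector (n + 1) ((Real.sqrt (n + 1) : ℂ) • sectorInsert ψ n (comp n f)) := by
  simp only [cutCreation, FunLike.coe_sum, Finset.sum_apply, FunLike.coe_smul, Pi.smul_apply,
    map_smul]
  rfl

theorem comp_cutAnnihilation (φ : h) (K n : ℕ) (f : Fock h) :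
    comp n (cutAnnihilation φ K f) = if n < K then annihilationComp φ n f else 0 := by
  rw [cutAnnihilation_apply, map_sum]
  split_ifs with hn
  · rw [Finset.sum_eq_single n, comp_ofSector_self]
    · exact fun m _ hm => comp_ofSector_ne hm.symm _
    · exact fun hm => absurd (Finset.mem_range.2 hn) hm
  · exact Finset.sum_eq_zero fun m hm => comp_ofSector_ne (by rw [Finset.mem_range] at hm; omega) _

theorem comp_cutCreation_zero (ψ : h) (K : ℕ) (f : Fock h) : comp 0 (cutCreation ψ K f) = 0 := by
  rw [cutCreation_apply, map_sum]
  exact Finset.sum_eq_zero fun m _ => comp_ofSector_ne (by omega) _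

theorem comp_cutCreation_succ (ψ : h) (K n : ℕ) (f : Fock h) :
    comp (n + 1) (cutCreation ψ K f) =
      if n < K then (Real.sqrt (n + 1) : ℂ) • sectorInsert ψ n (comp n f) else 0 := by
  rw [cutCreation_apply, map_sum]
  split_ifs with hn
  · rw [Finset.sum_eq_single n, comp_ofSector_self]
    · exact fun m _ hm => comp_ofSector_ne (by omega) _
    · exact fun hm => absurd (Finset.mem_range.2 hn) hm
  · exact Finset.sum_eq_zero fun m hm => comp_ofSector_ne (by rw [Finset.mem_range] at hm; omega) _

theorem inner_cutCreation (ψ : h) (K : ℕ) (f g : Fock h) :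
    ⟪cutCreation ψ K f, g⟫_ℂ = ⟪f, cutAnnihilation ψ K g⟫_ℂ := by
  rw [cutCreation_apply, cutAnnihilation_apply, sum_inner, inner_sum]
  refine Finset.sum_congr rfl fun n _ => ?_
  rw [inner_ofSector_left, inner_ofSector_right, annihilationComp_apply, inner_smul_left,
    inner_smul_right, Complex.conj_ofReal, sectorInsert, ContinuousLinearMap.adjoint_inner_left]

/-- Only components `n < K` survive, where `√(n + 1) ≤ √K`. The square root is essential later: it
gives words a growth of `√(l!)` and not `l!`. -/
theorem norm_cutAnnihilation_le (φ : h) (K : ℕ) : ‖cutAnnihilation φ K‖ ≤ √K * ‖φ‖ := by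
  refine ContinuousLinearMap.opNorm_le_bound _ (by positivity) fun f => ?_
  have hle : ∀ n, ‖comp n (cutAnnihilation φ K f)‖ ^ 2 ≤
      (√K * ‖φ‖) ^ 2 * ‖comp (n + 1) f‖ ^ 2 := fun n => by
    rw [comp_cutAnnihilation, ← mul_pow]
    split_ifs with hn
    · rw [annihilationComp_apply, norm_smul, Complex.norm_real, Real.norm_of_nonneg (by positivity),
        mul_assoc]
      gcongr
      · exact_mod_cast hn
      · exact (sectorContract φ n).le_of_opNorm_le (norm_sectorContract_le φ n) _
    · simp only [norm_zero, ne_eq, OfNat.ofNat_ne_zero, not_false_eq_true, zero_pow]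
      positivity
  have hf := hasSum_norm_comp_sq f
  have hs : Summable fun n => ‖comp (n + 1) f‖ ^ 2 :=
    (summable_nat_add_iff 1 (f := fun n => ‖comp n f‖ ^ 2)).2 hf.summable
  have hs' : ∑' n, ‖comp (n + 1) f‖ ^ 2 ≤ ‖f‖ ^ 2 := by
    rw [← hf.tsum_eq, hf.summable.tsum_eq_zero_add]
    exact le_add_of_nonneg_left (by positivity)
  refine (sq_le_sq₀ (norm_nonneg _) (by positivity)).1 ?_
  calc ‖cutAnnihilation φ K f‖ ^ 2
      ≤ (√K * ‖φ‖) ^ 2 * ∑' n, ‖comp (n + 1) f‖ ^ 2 :=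
        hasSum_le hle (hasSum_norm_comp_sq _) (hs.hasSum.mul_left _)
    _ ≤ (√K * ‖φ‖) ^ 2 * ‖f‖ ^ 2 := by gcongr
    _ = (√K * ‖φ‖ * ‖f‖) ^ 2 := by ring

/-! ### Annihilation and creation on finite-particle vectors -/

theorem annihilationComp_eq_zero (φ : h) {K : ℕ} {f : Fock h} (hf : f ∈ fewParticles h K) {n : ℕ}
    (hn : K ≤ n + 1) : annihilationComp φ n f = 0 := by
  rw [annihilationComp_apply, hf _ hn, map_zero, smul_zero]

theorem comp_cutAnnihilation_of_mem (φ : h) {K : ℕ} {f : Fock h} (hf : f ∈ fewParticles h K)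
    (n : ℕ) : comp n (cutAnnihilation φ K f) = annihilationComp φ n f := by
  rw [comp_cutAnnihilation]
  split_ifs with hn
  · rfl
  · rw [annihilationComp_eq_zero φ hf (by omega)]

theorem mem_annihilation_domain {φ : h} {f : Fock h} :
    f ∈ (annihilation φ).domain ↔ Memℓp (fun n => annihilationComp φ n f) 2 := Iff.rfl

theorem comp_annihilation (φ : h) (n : ℕ) (f : (annihilation φ).domain) :
    comp n (annihilation φ f) = annihilationComp φ n f := rfl

theorem fewParticles_le_annihilation (φ : h) (K : ℕ) :
    fewParticles h K ≤ (annihilation φ).domain := fun f hf => by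
  rw [mem_annihilation_domain, ← funext (comp_cutAnnihilation_of_mem φ hf)]
  exact memℓp_comp _

theorem annihilation_of_mem (φ : h) {K : ℕ} {f : Fock h} (hf : f ∈ fewParticles h K) :
    annihilation φ ⟨f, fewParticles_le_annihilation φ K hf⟩ = cutAnnihilation φ K f :=
  fock_ext fun n => by rw [comp_annihilation, comp_cutAnnihilation_of_mem φ hf]

theorem cutAnnihilation_mem (φ : h) (K : ℕ) (f : Fock h) :
    cutAnnihilation φ K f ∈ fewParticles h K := fun n hn => by
  rw [comp_cutAnnihilation, if_neg (by omega)]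

theorem cutCreation_mem (ψ : h) (K : ℕ) (f : Fock h) :
    cutCreation ψ K f ∈ fewParticles h (K + 1) := fun n hn => by
  obtain ⟨n, rfl⟩ : ∃ m, n = m + 1 := ⟨n - 1, by omega⟩
  rw [comp_cutCreation_succ, if_neg (by omega)]

theorem finiteParticle_le_annihilation (φ : h) :
    finiteParticle h ≤ (annihilation φ).domain := fun _ ⟨K, hf⟩ =>
  fewParticles_le_annihilation φ K hf

theorem dense_annihilation (φ : h) : Dense ((annihilation φ).domain : Set (Fock h)) :=
  dense_finiteParticle.mono (finiteParticle_le_annihilation φ)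

/-- On the natural domain the graph is cut out by one continuous equation per component;
square-summability is automatic since the components of `g` are square-summable. -/
theorem annihilation_isClosed (φ : h) : (annihilation φ).IsClosed := by
  have : ((annihilation φ).graph : Set (Fock h × Fock h)) =
      ⋂ n, {x | annihilationComp φ n x.1 = comp n x.2} := by
    ext ⟨f, g⟩
    simp only [SetLike.mem_coe, LinearPMap.mem_graph_iff, Set.mem_iInter, Set.mem_ofPred_eq]
    constructor
    · rintro ⟨y, rfl, rfl⟩ n
      rfl
    · intro H
      have hf : f ∈ (annihilation φ).domain := by
        rw [mem_annihilation_domain, funext H]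
        exact memℓp_comp g
      exact ⟨⟨f, hf⟩, rfl, fock_ext H⟩
  rw [LinearPMap.IsClosed, this]
  exact isClosed_iInter fun n => isClosed_eq
    ((continuous_annihilationComp φ n).comp continuous_fst) ((continuous_comp n).comp continuous_snd)

theorem creation_isFormalAdjoint (φ : h) : (creation φ).IsFormalAdjoint (annihilation φ) :=
  (annihilation φ).adjoint_isFormalAdjoint (dense_annihilation φ)

/-- Here `g` ranges over the whole domain of `annihilation ψ`: the components at which the cutoff
changes the right side are paired with zero components of `f`. So `cutCreation ψ K f` is the value
of the true adjoint. -/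
theorem inner_cutCreation_annihilation (ψ : h) {K : ℕ} {f : Fock h} (hf : f ∈ fewParticles h K)
    (g : (annihilation ψ).domain) :
    ⟪cutCreation ψ K f, (g : Fock h)⟫_ℂ = ⟪f, annihilation ψ g⟫_ℂ := by
  rw [inner_cutCreation, inner_fock, inner_fock]
  refine tsum_congr fun n => ?_
  rw [comp_cutAnnihilation, comp_annihilation]
  split_ifs with hn
  · rfl
  · rw [hf n (by omega), inner_zero_left, inner_zero_left]

theorem fewParticles_le_creation (ψ : h) (K : ℕ) :
    fewParticles h K ≤ (creation ψ).domain := fun f hf =>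
  LinearPMap.mem_adjoint_domain_of_exists _
    ⟨cutCreation ψ K f, inner_cutCreation_annihilation ψ hf⟩

theorem creation_of_mem (ψ : h) {K : ℕ} {f : Fock h} (hf : f ∈ fewParticles h K) :
    creation ψ ⟨f, fewParticles_le_creation ψ K hf⟩ = cutCreation ψ K f :=
  LinearPMap.adjoint_apply_eq (dense_annihilation ψ) _ (inner_cutCreation_annihilation ψ hf)

theorem finiteParticle_le_creation (ψ : h) :
    finiteParticle h ≤ (creation ψ).domain := fun _ ⟨K, hf⟩ =>
  fewParticles_le_creation ψ K hf

/-- The restriction of an operator that preserves a subspace of its domain to that subspace. -/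
def restrictTo {E : Type*} [AddCommGroup E] [Module ℂ E] (T : E →ₗ.[ℂ] E) (D : Submodule ℂ E)
    (hD : D ≤ T.domain) (H : ∀ x (hx : x ∈ D), T ⟨x, hD hx⟩ ∈ D) : D →ₗ[ℂ] D :=
  (T.toFun ∘ₗ Submodule.inclusion hD).codRestrict D fun x => H x x.2

/-- The annihilation operator on finite-particle vectors. -/
def finAnnihilation (φ : h) : finiteParticle h →ₗ[ℂ] finiteParticle h :=
  restrictTo (annihilation φ) _ (finiteParticle_le_annihilation φ) fun f ⟨K, hf⟩ => by
    rw [annihilation_of_mem φ hf]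
    exact fewParticles_le K (cutAnnihilation_mem φ K f)

/-- The creation operator on finite-particle vectors. -/
def finCreation (ψ : h) : finiteParticle h →ₗ[ℂ] finiteParticle h :=
  restrictTo (creation ψ) _ (finiteParticle_le_creation ψ) fun f ⟨K, hf⟩ => by
    rw [creation_of_mem ψ hf]
    exact fewParticles_le (K + 1) (cutCreation_mem ψ K f)

theorem coe_finAnnihilation_eq (φ : h) {K : ℕ} (f : finiteParticle h)
    (hf : (f : Fock h) ∈ fewParticles h K) :
    (finAnnihilation φ f : Fock h) = cutAnnihilation φ K f := annihilation_of_mem φ hf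

theorem coe_finCreation_eq (ψ : h) {K : ℕ} (f : finiteParticle h)
    (hf : (f : Fock h) ∈ fewParticles h K) :
    (finCreation ψ f : Fock h) = cutCreation ψ K f := creation_of_mem ψ hf

theorem comp_finAnnihilation (φ : h) (n : ℕ) (f : finiteParticle h) :
    comp n (finAnnihilation φ f : Fock h) =
      (Real.sqrt (n + 1) : ℂ) • sectorContract φ n (comp (n + 1) (f : Fock h)) := rfl

theorem comp_finCreation_zero (ψ : h) (f : finiteParticle h) :
    comp 0 (finCreation ψ f : Fock h) = 0 := by
  obtain ⟨K, hf⟩ := mem_finiteParticle.1 f.2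
  rw [coe_finCreation_eq ψ _ hf, comp_cutCreation_zero]

theorem comp_finCreation_succ (ψ : h) (n : ℕ) (f : finiteParticle h) :
    comp (n + 1) (finCreation ψ f : Fock h) =
      (Real.sqrt (n + 1) : ℂ) • sectorInsert ψ n (comp n (f : Fock h)) := by
  obtain ⟨K, hf⟩ := mem_finiteParticle.1 f.2
  rw [coe_finCreation_eq ψ _ hf, comp_cutCreation_succ]
  split_ifs with hn
  · rfl
  · rw [hf n (by omega), map_zero, smul_zero]

theorem sqrt_succ_mul_self (n : ℕ) :
    ((Real.sqrt (n + 1) : ℝ) : ℂ) * (Real.sqrt (n + 1) : ℝ) = (n : ℂ) + 1 := by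
  rw [← Complex.ofReal_mul, Real.mul_self_sqrt (by positivity)]
  push_cast
  rfl

/-- The canonical commutation relations on finite-particle vectors. -/
theorem finAnnihilation_mul_finCreation (φ ψ : h) :
    finAnnihilation φ * finCreation ψ = finCreation ψ * finAnnihilation φ + ⟪φ, ψ⟫_ℂ • 1 := by
  refine LinearMap.ext fun f => Subtype.ext (fock_ext fun n => ?_)
  have hsum : comp n ((((finCreation ψ * finAnnihilation φ + ⟪φ, ψ⟫_ℂ • 1 :
      Module.End ℂ (finiteParticle h)) f : finiteParticle h)) : Fock h) =
      comp n (finCreation ψ (finAnnihilation φ f) : Fock h) + ⟪φ, ψ⟫_ℂ • comp n (f : Fock h) := rfl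
  rw [hsum, Module.End.mul_apply, comp_finAnnihilation, comp_finCreation_succ, map_smul, smul_smul,
    sqrt_succ_mul_self]
  cases n with
  | zero =>
    rw [comp_finCreation_zero, sectorContract_sectorInsert_zero]
    simp
  | succ n =>
    rw [comp_finCreation_succ, comp_finAnnihilation, map_smul, smul_smul, sqrt_succ_mul_self,
      show (((n + 1 : ℕ) : ℂ) + 1) = (n : ℂ) + 2 by push_cast; ring,
      sectorContract_sectorInsert_succ]
    exact add_comm _ _

end FockSpace

/-! ### Products, sums, adjoints, closures and tensor products of operators through their graphs. -/

section UnboundedOperators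

variable {E F G : Type*} [NormedAddCommGroup E] [InnerProductSpace ℂ E]
  [NormedAddCommGroup F] [InnerProductSpace ℂ F] [NormedAddCommGroup G] [InnerProductSpace ℂ G]

/-! ### Graphs of unbounded operators -/

theorem mem_graph_opId {x y : E} : (x, y) ∈ (opId E).graph ↔ x = y := by
  rw [LinearPMap.mem_graph_iff]
  constructor
  · rintro ⟨z, rfl, hz⟩
    exact hz
  · rintro rfl
    exact ⟨⟨x, trivial⟩, rfl, rfl⟩

/-- Products become compositions of relations, so that inductions over words need not carry domain
proofs inside terms. -/
theorem mem_graph_opComp {S : F →ₗ.[ℂ] G} {T : E →ₗ.[ℂ] F} {x : E} {z : G} :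
    (x, z) ∈ (opComp S T).graph ↔ ∃ y, (x, y) ∈ T.graph ∧ (y, z) ∈ S.graph := by
  constructor
  · intro H
    obtain ⟨⟨x, hx⟩, rfl, hz⟩ := (LinearPMap.mem_graph_iff _).1 H
    obtain ⟨hxT, hxS⟩ := (mem_opComp_domain S T x).1 hx
    refine ⟨_, T.mem_graph ⟨x, hxT⟩, (LinearPMap.mem_graph_iff _).2 ⟨⟨_, hxS⟩, rfl, ?_⟩⟩
    rw [← hz, opComp_apply S T x hxT hxS hx]
  · rintro ⟨y, hT, hS⟩
    obtain ⟨⟨x, hx⟩, rfl, rfl⟩ := (LinearPMap.mem_graph_iff _).1 hT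
    have hy : T ⟨x, hx⟩ ∈ S.domain := S.mem_domain_of_mem_graph hS
    have hx' := (mem_opComp_domain S T x).2 ⟨hx, hy⟩
    refine (LinearPMap.mem_graph_iff _).2 ⟨⟨x, hx'⟩, rfl, ?_⟩
    exact (opComp_apply S T x hx hy hx').trans
      (LinearPMap.mem_graph_snd_inj S (S.mem_graph ⟨_, hy⟩) hS rfl)

theorem add_mem_graph_add {S T : E →ₗ.[ℂ] F} {x : E} {y z : F} (hS : (x, y) ∈ S.graph)
    (hT : (x, z) ∈ T.graph) : (x, y + z) ∈ (S + T).graph := by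
  obtain ⟨⟨x, hx⟩, rfl, rfl⟩ := (LinearPMap.mem_graph_iff _).1 hS
  obtain ⟨⟨x', hx'⟩, rfl, rfl⟩ := (LinearPMap.mem_graph_iff _).1 hT
  exact (LinearPMap.mem_graph_iff _).2 ⟨⟨x', hx, hx'⟩, rfl, LinearPMap.add_apply S T _⟩

theorem exists_of_mem_graph_add {S T : E →ₗ.[ℂ] F} {p : E × F} (hp : p ∈ (S + T).graph) :
    ∃ x y z, p = (x, y + z) ∧ (x, y) ∈ S.graph ∧ (x, z) ∈ T.graph := by
  obtain ⟨⟨x, hx, hx'⟩, h1, h2⟩ := (LinearPMap.mem_graph_iff _).1 hp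
  refine ⟨x, _, _, ?_, S.mem_graph ⟨x, hx⟩, T.mem_graph ⟨x, hx'⟩⟩
  exact Prod.ext h1.symm (h2.symm.trans (LinearPMap.add_apply S T _))

theorem opExt_eq_of_mem_graph {T : E →ₗ.[ℂ] F} {x : E} {y : F} (H : (x, y) ∈ T.graph) :
    opExt T x = y := by
  obtain ⟨⟨x, hx⟩, rfl, rfl⟩ := (LinearPMap.mem_graph_iff _).1 H
  exact opExt_of_mem T hx

theorem mem_graph_opExt {T : E →ₗ.[ℂ] F} {x : E} (hx : x ∈ T.domain) :
    (x, opExt T x) ∈ T.graph :=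
  opExt_of_mem T hx ▸ T.mem_graph ⟨x, hx⟩

theorem mem_domain_of_mem_graph {T : E →ₗ.[ℂ] F} {x : E} {y : F} (H : (x, y) ∈ T.graph) :
    x ∈ T.domain :=
  T.mem_domain_of_mem_graph H

theorem apply_eq_of_mem_graph {T : E →ₗ.[ℂ] F} {x : E} {y : F} (H : (x, y) ∈ T.graph)
    (hx : x ∈ T.domain) : T ⟨x, hx⟩ = y :=
  (opExt_of_mem T hx).symm.trans (opExt_eq_of_mem_graph H)

theorem mem_graph_adjoint [CompleteSpace E] {T : E →ₗ.[ℂ] F} (hT : Dense (T.domain : Set E))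
    {y : F} {z : E} :
    (y, z) ∈ T.adjoint.graph ↔ ∀ p ∈ T.graph, ⟪z, p.1⟫_ℂ = ⟪y, p.2⟫_ℂ := by
  constructor
  · rintro H ⟨x, w⟩ hp
    obtain ⟨y, rfl, rfl⟩ := (LinearPMap.mem_graph_iff _).1 H
    obtain ⟨x, rfl, rfl⟩ := (LinearPMap.mem_graph_iff _).1 hp
    exact LinearPMap.adjoint_isFormalAdjoint hT y x
  · intro H
    have H' : ∀ x : T.domain, ⟪z, (x : E)⟫_ℂ = ⟪y, T x⟫_ℂ := fun x => H _ (T.mem_graph x)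
    exact (LinearPMap.mem_graph_iff _).2
      ⟨⟨y, LinearPMap.mem_adjoint_domain_of_exists y ⟨z, H'⟩⟩, rfl,
        LinearPMap.adjoint_apply_eq hT _ H'⟩

theorem graph_closure_subset {T : E →ₗ.[ℂ] F} (hT : T.IsClosable) {C : Set (E × F)}
    (hC : IsClosed C) (H : ∀ p ∈ T.graph, p ∈ C) {p : E × F} (hp : p ∈ T.closure.graph) :
    p ∈ C := by
  rw [← hT.graph_closure_eq_closure_graph] at hp
  exact closure_minimal H hC hp

/-- `T` is contained in the adjoint of the densely defined `S`, and adjoints are closed. -/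
theorem isClosable_of_isFormalAdjoint [CompleteSpace E] {S : E →ₗ.[ℂ] F} {T : F →ₗ.[ℂ] E}
    (hST : S.IsFormalAdjoint T) (hS : Dense (S.domain : Set E)) : T.IsClosable :=
  (LinearPMap.adjoint_isClosed hS).isClosable.leIsClosable (hST.le_adjoint hS)

theorem isFormalAdjoint_opId : (opId E).IsFormalAdjoint (opId E) := fun _ _ => rfl

theorem isFormalAdjoint_add {S₁ S₂ : E →ₗ.[ℂ] F} {T₁ T₂ : F →ₗ.[ℂ] E}
    (h₁ : S₁.IsFormalAdjoint T₁) (h₂ : S₂.IsFormalAdjoint T₂) :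
    (S₁ + S₂).IsFormalAdjoint (T₁ + T₂) := fun x y => by
  rw [LinearPMap.add_apply, LinearPMap.add_apply, inner_add_left, inner_add_right]
  exact congrArg₂ (· + ·) (h₁ ⟨x, x.2.1⟩ ⟨y, y.2.1⟩) (h₂ ⟨x, x.2.2⟩ ⟨y, y.2.2⟩)

theorem inner_htmul (x x' : E) (y y' : F) :
    ⟪htmul x y, htmul x' y'⟫_ℂ = ⟪x, x'⟫_ℂ * ⟪y, y'⟫_ℂ :=
  ((toHTensor E F).inner_map_map _ _).trans (TensorProduct.inner_tmul ..)

theorem isFormalAdjoint_opTensor {S S' : E →ₗ.[ℂ] E} {T T' : F →ₗ.[ℂ] F}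
    (hS : S.IsFormalAdjoint S') (hT : T.IsFormalAdjoint T') :
    (opTensor S T).IsFormalAdjoint (opTensor S' T') := by
  rintro ⟨_, s, rfl⟩ ⟨_, t, rfl⟩
  rw [opTensor_apply, opTensor_apply]
  induction s using TensorProduct.induction_on with
  | zero => simp
  | add s s' h1 h2 => simp only [map_add, inner_add_left, h1, h2]
  | tmul x y =>
    induction t using TensorProduct.induction_on with
    | zero => simp
    | add t t' h1 h2 => simp only [map_add, inner_add_right, h1, h2]
    | tmul x' y' =>
      change ⟪htmul (S x) (T y), htmul (x' : E) (y' : F)⟫_ℂ =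
        ⟪htmul (x : E) (y : F), htmul (S' x') (T' y')⟫_ℂ
      rw [inner_htmul, inner_htmul, hS, hT]

theorem htmul_mem_graph_opTensor {S : E →ₗ.[ℂ] E} {T : F →ₗ.[ℂ] F} {x x' : E} {y y' : F}
    (hx : (x, x') ∈ S.graph) (hy : (y, y') ∈ T.graph) :
    (htmul x y, htmul x' y') ∈ (opTensor S T).graph := by
  obtain ⟨x, rfl, rfl⟩ := (LinearPMap.mem_graph_iff _).1 hx
  obtain ⟨y, rfl, rfl⟩ := (LinearPMap.mem_graph_iff _).1 hy
  exact (LinearPMap.mem_graph_iff _).2 ⟨_, rfl, opTensor_htmul S T x y⟩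

/-- The graph of `S ⊗ T` is spanned by its elementary tensors. -/
theorem opTensor_graph_induction {S : E →ₗ.[ℂ] E} {T : F →ₗ.[ℂ] F}
    {C : Submodule ℂ (HTensor E F × HTensor E F)}
    (H : ∀ (x : S.domain) (y : T.domain), (htmul (x : E) (y : F), htmul (S x) (T y)) ∈ C) :
    (opTensor S T).graph ≤ C := by
  rintro p hp
  obtain ⟨⟨_, s, rfl⟩, h1, h2⟩ := (LinearPMap.mem_graph_iff _).1 hp
  obtain rfl : p = (domIncl S T s, domMap S T s) := by
    rw [opTensor_apply] at h2
    exact Prod.ext h1.symm h2.symm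
  clear hp h1 h2
  induction s using TensorProduct.induction_on with
  | zero => rw [map_zero, map_zero]; exact C.zero_mem
  | add s s' h1 h2 =>
    rw [map_add, map_add]
    exact C.add_mem h1 h2
  | tmul x y => exact H x y

/-! ### The algebraic tensor product of dense subspaces -/

/-- The inclusion of the algebraic tensor product of two subspaces. -/
def tensorIncl (D : Submodule ℂ E) (D' : Submodule ℂ F) : D ⊗[ℂ] D' →ₗ[ℂ] HTensor E F :=
  (toHTensor E F).toLinearMap ∘ₗ TensorProduct.map D.subtype D'.subtype

theorem tensorIncl_tmul (D : Submodule ℂ E) (D' : Submodule ℂ F) (x : D) (y : D') :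
    tensorIncl D D' (x ⊗ₜ[ℂ] y) = htmul (x : E) (y : F) := rfl

/-- Limits are taken in one factor at a time, first in `x` with `y` in `D'`, then in `y`; linearity
and completion do the rest. -/
theorem dense_range_tensorIncl {D : Submodule ℂ E} {D' : Submodule ℂ F}
    (hD : Dense (D : Set E)) (hD' : Dense (D' : Set F)) :
    Dense (LinearMap.range (tensorIncl D D') : Set (HTensor E F)) := by
  have hcl : ∀ x y, htmul x y ∈ (LinearMap.range (tensorIncl D D')).topologicalClosure := by
    have h1 : ∀ (x : E) (y : D'),
        htmul x (y : F) ∈ (LinearMap.range (tensorIncl D D')).topologicalClosure := fun x y =>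
      hD.induction (P := fun x =>
        htmul x (y : F) ∈ (LinearMap.range (tensorIncl D D')).topologicalClosure)
        (fun x hx => Submodule.le_topologicalClosure _ ⟨⟨x, hx⟩ ⊗ₜ y, rfl⟩)
        ((Submodule.isClosed_topologicalClosure _).preimage (tensorRight E (y : F)).continuous) x
    intro x y
    refine hD'.induction (P := fun y =>
      htmul x y ∈ (LinearMap.range (tensorIncl D D')).topologicalClosure)
      (fun y hy => h1 x ⟨y, hy⟩) ?_ y
    exact (Submodule.isClosed_topologicalClosure _).preimage
      ((toHTensor E F).continuous.comp (TensorProduct.mkL ℂ E F x).continuous)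
  intro z
  refine isClosed_property (p := fun z => z ∈ (LinearMap.range (tensorIncl D D')).topologicalClosure)
    denseRange_toHTensor (Submodule.isClosed_topologicalClosure _) (fun t => ?_) z
  induction t using TensorProduct.induction_on with
  | zero => rw [map_zero]; exact Submodule.zero_mem _
  | add s t hs ht => rw [map_add]; exact Submodule.add_mem _ hs ht
  | tmul x y => exact hcl x y

theorem tensorIncl_mem_graph_opTensor {S : E →ₗ.[ℂ] E} {T : F →ₗ.[ℂ] F} {D : Submodule ℂ E}
    {D' : Submodule ℂ F} {s : D →ₗ[ℂ] D} {t : D' →ₗ[ℂ] D'}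
    (hs : ∀ x : D, ((x : E), (s x : E)) ∈ S.graph) (ht : ∀ y : D', ((y : F), (t y : F)) ∈ T.graph)
    (z : D ⊗[ℂ] D') :
    (tensorIncl D D' z, tensorIncl D D' (TensorProduct.map s t z)) ∈ (opTensor S T).graph := by
  induction z using TensorProduct.induction_on with
  | zero => simp only [map_zero]; exact Submodule.zero_mem _
  | add z z' h1 h2 => simp only [map_add]; exact Submodule.add_mem _ h1 h2
  | tmul x y => exact htmul_mem_graph_opTensor (hs x) (ht y)

end UnboundedOperators

/-! ### The two intertwining relations with the vacuum embedding, and the sorting of words. -/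

section DoubledFock

variable {h : Type u} [NormedAddCommGroup h] [InnerProductSpace ℂ h]

/-! ### The fields on finite-particle vectors of the doubled Fock space -/

variable (h) in
/-- The algebraic tensor product of the finite-particle vectors. -/
abbrev FinTensor : Type u := finiteParticle h ⊗[ℂ] finiteParticle h

variable (h) in
/-- The inclusion of the finite-particle vectors into the doubled Fock space. -/
abbrev finIncl : FinTensor h →ₗ[ℂ] HTensor (Fock h) (Fock h) :=
  tensorIncl (finiteParticle h) (finiteParticle h)

/-- The sum of the two algebraic tensor product operators whose closure is `zField J φ`. -/
def zSum (J : h →ₗ⋆[ℂ] h) (φ : h) :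
    HTensor (Fock h) (Fock h) →ₗ.[ℂ] HTensor (Fock h) (Fock h) :=
  opTensor (annihilation φ) (opId (Fock h)) + opTensor (opId (Fock h)) (creation (J φ))

/-- The formal adjoint of `zSum J ψ`. -/
def zSumStar (J : h →ₗ⋆[ℂ] h) (ψ : h) :
    HTensor (Fock h) (Fock h) →ₗ.[ℂ] HTensor (Fock h) (Fock h) :=
  opTensor (creation ψ) (opId (Fock h)) + opTensor (opId (Fock h)) (annihilation (J ψ))

/-- The field `Z(φ)` on finite-particle vectors. -/
def finZ (J : h →ₗ⋆[ℂ] h) (φ : h) : Module.End ℂ (FinTensor h) :=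
  TensorProduct.map (finAnnihilation φ) 1 + TensorProduct.map 1 (finCreation (J φ))

/-- The field `Z(ψ)*` on finite-particle vectors. -/
def finZStar (J : h →ₗ⋆[ℂ] h) (ψ : h) : Module.End ℂ (FinTensor h) :=
  TensorProduct.map (finCreation ψ) 1 + TensorProduct.map 1 (finAnnihilation (J ψ))

theorem finAnnihilation_mem_graph (φ : h) (f : finiteParticle h) :
    ((f : Fock h), (finAnnihilation φ f : Fock h)) ∈ (annihilation φ).graph :=
  (annihilation φ).mem_graph ⟨f, finiteParticle_le_annihilation φ f.2⟩

theorem finCreation_mem_graph (ψ : h) (f : finiteParticle h) :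
    ((f : Fock h), (finCreation ψ f : Fock h)) ∈ (creation ψ).graph :=
  (creation ψ).mem_graph ⟨f, finiteParticle_le_creation ψ f.2⟩

theorem finIncl_mem_graph_zSum (J : h →ₗ⋆[ℂ] h) (φ : h) (z : FinTensor h) :
    (finIncl h z, finIncl h (finZ J φ z)) ∈ (zSum J φ).graph := by
  rw [finZ, LinearMap.add_apply, map_add]
  exact add_mem_graph_add
    (tensorIncl_mem_graph_opTensor (finAnnihilation_mem_graph φ) (fun _ => mem_graph_opId.2 rfl) z)
    (tensorIncl_mem_graph_opTensor (fun _ => mem_graph_opId.2 rfl)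
      (finCreation_mem_graph (J φ)) z)

theorem finIncl_mem_graph_zSumStar (J : h →ₗ⋆[ℂ] h) (ψ : h) (z : FinTensor h) :
    (finIncl h z, finIncl h (finZStar J ψ z)) ∈ (zSumStar J ψ).graph := by
  rw [finZStar, LinearMap.add_apply, map_add]
  exact add_mem_graph_add
    (tensorIncl_mem_graph_opTensor (finCreation_mem_graph ψ) (fun _ => mem_graph_opId.2 rfl) z)
    (tensorIncl_mem_graph_opTensor (fun _ => mem_graph_opId.2 rfl)
      (finAnnihilation_mem_graph (J ψ)) z)

theorem dense_range_finIncl :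
    Dense (LinearMap.range (finIncl h) : Set (HTensor (Fock h) (Fock h))) :=
  dense_range_tensorIncl dense_finiteParticle dense_finiteParticle

theorem zSumStar_isFormalAdjoint (J : h →ₗ⋆[ℂ] h) (φ : h) :
    (zSumStar J φ).IsFormalAdjoint (zSum J φ) :=
  isFormalAdjoint_add
    (isFormalAdjoint_opTensor (creation_isFormalAdjoint φ) isFormalAdjoint_opId)
    (isFormalAdjoint_opTensor isFormalAdjoint_opId (creation_isFormalAdjoint (J φ)).symm)

theorem zSum_isClosable (J : h →ₗ⋆[ℂ] h) (φ : h) : (zSum J φ).IsClosable := by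
  refine isClosable_of_isFormalAdjoint (zSumStar_isFormalAdjoint J φ)
    (dense_range_finIncl.mono ?_)
  rintro _ ⟨z, rfl⟩
  exact mem_domain_of_mem_graph (finIncl_mem_graph_zSumStar J φ z)

theorem zField_eq (J : h →ₗ⋆[ℂ] h) (φ : h) : zField J φ = (zSum J φ).closure := rfl

theorem zSum_le_zField (J : h →ₗ⋆[ℂ] h) (φ : h) : zSum J φ ≤ zField J φ :=
  LinearPMap.le_closure _

theorem finIncl_mem_graph_zField (J : h →ₗ⋆[ℂ] h) (φ : h) (z : FinTensor h) :
    (finIncl h z, finIncl h (finZ J φ z)) ∈ (zField J φ).graph :=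
  LinearPMap.le_graph_of_le (zSum_le_zField J φ) (finIncl_mem_graph_zSum J φ z)

theorem dense_zField (J : h →ₗ⋆[ℂ] h) (φ : h) :
    Dense ((zField J φ).domain : Set (HTensor (Fock h) (Fock h))) := by
  refine dense_range_finIncl.mono ?_
  rintro _ ⟨z, rfl⟩
  exact mem_domain_of_mem_graph (finIncl_mem_graph_zField J φ z)

/-- The adjoint relation for a fixed `z` is a closed condition on the graph, so it passes from the
operator sum to its closure. -/
theorem finIncl_mem_graph_zField_adjoint (J : h →ₗ⋆[ℂ] h) (ψ : h) (z : FinTensor h) :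
    (finIncl h z, finIncl h (finZStar J ψ z)) ∈ (zField J ψ).adjoint.graph := by
  refine (mem_graph_adjoint (dense_zField J ψ)).2 fun p hp => ?_
  refine graph_closure_subset (zSum_isClosable J ψ)
    (C := {p | ⟪finIncl h (finZStar J ψ z), p.1⟫_ℂ = ⟪finIncl h z, p.2⟫_ℂ})
    (isClosed_eq (by fun_prop) (by fun_prop)) ?_ hp
  rintro ⟨x, y⟩ hp
  obtain ⟨x, rfl, rfl⟩ := (LinearPMap.mem_graph_iff _).1 hp
  obtain ⟨w, hw, hw'⟩ := (LinearPMap.mem_graph_iff _).1 (finIncl_mem_graph_zSumStar J ψ z)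
  dsimp only at hw hw' ⊢
  rw [Set.mem_ofPred_eq, ← hw, ← hw']
  exact zSumStar_isFormalAdjoint J ψ w x

/-- The letters on finite-particle vectors. -/
def finLetter (J : h →ₗ⋆[ℂ] h) : h ⊕ h → Module.End ℂ (FinTensor h)
  | .inl φ => finZ J φ
  | .inr ψ => finZStar J ψ

/-- The words on finite-particle vectors. -/
def finWord (J : h →ₗ⋆[ℂ] h) (w : List (h ⊕ h)) : Module.End ℂ (FinTensor h) :=
  (w.map (finLetter J)).prod

theorem finIncl_mem_graph_zLetter (J : h →ₗ⋆[ℂ] h) (l : h ⊕ h) (z : FinTensor h) :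
    (finIncl h z, finIncl h (finLetter J l z)) ∈ (zLetter J l).graph :=
  match l with
  | .inl φ => finIncl_mem_graph_zField J φ z
  | .inr ψ => finIncl_mem_graph_zField_adjoint J ψ z

theorem finWord_cons (J : h →ₗ⋆[ℂ] h) (l : h ⊕ h) (w : List (h ⊕ h)) :
    finWord J (l :: w) = finLetter J l * finWord J w := by
  simp [finWord]

theorem zLetter_inl (J : h →ₗ⋆[ℂ] h) (φ : h) : zLetter J (.inl φ) = zField J φ := rfl

theorem zLetter_inr (J : h →ₗ⋆[ℂ] h) (ψ : h) : zLetter J (.inr ψ) = (zField J ψ).adjoint := rfl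

theorem aLetter_inl (φ : h) : aLetter (.inl φ) = annihilation φ := rfl

theorem aLetter_inr (ψ : h) : aLetter (.inr ψ) = creation ψ := rfl

theorem zWord_cons (J : h →ₗ⋆[ℂ] h) (l : h ⊕ h) (w : List (h ⊕ h)) :
    zWord J (l :: w) = opComp (zLetter J l) (zWord J w) := rfl

theorem aWord_cons (l : h ⊕ h) (w : List (h ⊕ h)) :
    aWord (l :: w) = opComp (aLetter l) (aWord w) := rfl

theorem finIncl_mem_graph_zWord (J : h →ₗ⋆[ℂ] h) (w : List (h ⊕ h)) (z : FinTensor h) :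
    (finIncl h z, finIncl h (finWord J w z)) ∈ (zWord J w).graph := by
  induction w with
  | nil => exact mem_graph_opId.2 rfl
  | cons l w ih =>
    rw [zWord_cons, mem_graph_opComp, finWord_cons]
    exact ⟨_, ih, finIncl_mem_graph_zLetter J l _⟩

/-! ### The partial vacuum expectation of ordered words -/

variable (h) in
/-- The adjoint of `v ↦ v ⊗ Ω`. -/
abbrev vacProj : HTensor (Fock h) (Fock h) →L[ℂ] Fock h :=
  ContinuousLinearMap.adjoint (tensorRight (Fock h) (vacuum h))

theorem vacProj_htmul (u w : Fock h) : vacProj h (htmul u w) = ⟪vacuum h, w⟫_ℂ • u := by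
  refine ext_inner_left ℂ fun v => ?_
  rw [ContinuousLinearMap.adjoint_inner_right, tensorRight_apply, inner_htmul, inner_smul_right,
    mul_comm]

theorem inner_vacuum_vacuum : ⟪vacuum h, vacuum h⟫_ℂ = 1 := by
  rw [inner_self_eq_norm_sq_to_K, norm_vacuum]
  simp

theorem vacProj_htmul_vacuum (u : Fock h) : vacProj h (htmul u (vacuum h)) = u := by
  rw [vacProj_htmul, inner_vacuum_vacuum, one_smul]

theorem vacuum_mem_finiteParticle : vacuum h ∈ finiteParticle h := fewParticles_le 1 vacuum_mem

theorem annihilation_vacuum (φ : h) (hΩ : vacuum h ∈ (annihilation φ).domain) :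
    annihilation φ ⟨vacuum h, hΩ⟩ = 0 :=
  fock_ext fun n => (annihilationComp_eq_zero φ vacuum_mem (by omega)).trans (map_zero _).symm

/-- Moving the creation operator to the other side makes it annihilate the vacuum. -/
theorem inner_vacuum_creation (ψ : h) (w : (creation ψ).domain) :
    ⟪vacuum h, creation ψ w⟫_ℂ = 0 := by
  have hΩ := finiteParticle_le_annihilation ψ (vacuum_mem_finiteParticle (h := h))
  rw [← (creation_isFormalAdjoint ψ).symm ⟨vacuum h, hΩ⟩ w, annihilation_vacuum, inner_zero_left]

theorem mem_graph_vacExp {X : HTensor (Fock h) (Fock h) →ₗ.[ℂ] HTensor (Fock h) (Fock h)}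
    {v u : Fock h} : (v, u) ∈ (vacExp X).graph ↔
      ∃ y, (htmul v (vacuum h), y) ∈ X.graph ∧ vacProj h y = u := by
  constructor
  · intro H
    obtain ⟨⟨v, hv⟩, rfl, rfl⟩ := (LinearPMap.mem_graph_iff _).1 H
    exact ⟨_, X.mem_graph ⟨_, hv⟩, rfl⟩
  · rintro ⟨y, hy, rfl⟩
    have hv : v ∈ (vacExp X).domain := mem_domain_of_mem_graph (T := X) hy
    refine (LinearPMap.mem_graph_iff _).2 ⟨⟨v, hv⟩, rfl, ?_⟩
    exact congrArg (vacProj h) (apply_eq_of_mem_graph hy hv)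

theorem vacProj_mem_graph_of_opTensor_left (φ : h)
    {p : HTensor (Fock h) (Fock h) × HTensor (Fock h) (Fock h)}
    (hp : p ∈ (opTensor (annihilation φ) (opId (Fock h))).graph) :
    (vacProj h p.1, vacProj h p.2) ∈ (annihilation φ).graph := by
  have key : (opTensor (annihilation φ) (opId (Fock h))).graph ≤
      (annihilation φ).graph.comap ((vacProj h).toLinearMap.prodMap (vacProj h).toLinearMap) := by
    refine opTensor_graph_induction fun x y => ?_
    rw [Submodule.mem_comap]
    change (vacProj h (htmul (x : Fock h) (y : Fock h)),
      vacProj h (htmul (annihilation φ x) (y : Fock h))) ∈ (annihilation φ).graph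
    rw [vacProj_htmul, vacProj_htmul]
    exact (annihilation φ).graph.smul_mem ⟪vacuum h, (y : Fock h)⟫_ℂ ((annihilation φ).mem_graph x)
  exact key hp

theorem vacProj_eq_zero_of_opTensor_right (ψ : h)
    {p : HTensor (Fock h) (Fock h) × HTensor (Fock h) (Fock h)}
    (hp : p ∈ (opTensor (opId (Fock h)) (creation ψ)).graph) : vacProj h p.2 = 0 := by
  have key : (opTensor (opId (Fock h)) (creation ψ)).graph ≤
      (LinearMap.ker (vacProj h).toLinearMap).comap (LinearMap.snd ℂ _ _) := by
    refine opTensor_graph_induction fun x y => ?_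
    rw [Submodule.mem_comap, LinearMap.mem_ker]
    change vacProj h (htmul (x : Fock h) (creation ψ y)) = 0
    rw [vacProj_htmul, inner_vacuum_creation, zero_smul]
  exact key hp

theorem vacProj_mem_graph_of_zSum (J : h →ₗ⋆[ℂ] h) (φ : h)
    {p : HTensor (Fock h) (Fock h) × HTensor (Fock h) (Fock h)} (hp : p ∈ (zSum J φ).graph) :
    (vacProj h p.1, vacProj h p.2) ∈ (annihilation φ).graph := by
  obtain ⟨x, y, z, rfl, hy, hz⟩ := exists_of_mem_graph_add hp
  have e := vacProj_eq_zero_of_opTensor_right (J φ) hz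
  have := vacProj_mem_graph_of_opTensor_left φ hy
  dsimp only at e this ⊢
  rw [map_add, e, add_zero]
  exact this

/-- The partial vacuum expectation intertwines `Z(φ)` with `A(φ)`. -/
theorem vacProj_mem_graph_annihilation (J : h →ₗ⋆[ℂ] h) (φ : h)
    {x y : HTensor (Fock h) (Fock h)} (hxy : (x, y) ∈ (zField J φ).graph) :
    (vacProj h x, vacProj h y) ∈ (annihilation φ).graph := by
  have hc : IsClosed ((annihilation φ).graph : Set (Fock h × Fock h)) := annihilation_isClosed φ
  -- As `vacProj` is bounded and `annihilation φ` is closed, the claim is a closed condition on `(x,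
  -- y)` and survives the closure in `zField`.
  have hC := hc.preimage (((vacProj h).continuous.comp continuous_fst).prodMk
    ((vacProj h).continuous.comp continuous_snd))
  rw [zField_eq] at hxy
  have key := graph_closure_subset (zSum_isClosable J φ) hC
    (fun p hp => vacProj_mem_graph_of_zSum J φ hp) hxy
  exact key

/-- On vectors `v ⊗ Ω`, the operator `Z(ψ)*` acts as `A(ψ)* ⊗ 1`. -/
theorem mem_graph_creation_of_htmul_vacuum (J : h →ₗ⋆[ℂ] h) (ψ : h) {v : Fock h}
    {y : HTensor (Fock h) (Fock h)}
    (H : (htmul v (vacuum h), y) ∈ (zField J ψ).adjoint.graph) :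
    ∃ u, y = htmul u (vacuum h) ∧ (v, u) ∈ (creation ψ).graph := by
  rw [mem_graph_adjoint (dense_zField J ψ)] at H
  -- In the adjoint relation tested on `a ⊗ b`, the term with `creation (J ψ) b` vanishes because it
  -- is orthogonal to the vacuum.
  have key : ∀ (a : (annihilation ψ).domain) (b : (creation (J ψ)).domain),
      ⟪y, htmul (a : Fock h) (b : Fock h)⟫_ℂ = ⟪v, annihilation ψ a⟫_ℂ * ⟪vacuum h, b⟫_ℂ := by
    intro a b
    have hab := LinearPMap.le_graph_of_le (zSum_le_zField J ψ)
      (add_mem_graph_add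
        (htmul_mem_graph_opTensor ((annihilation ψ).mem_graph a)
          (mem_graph_opId.2 (rfl : (b : Fock h) = b)))
        (htmul_mem_graph_opTensor (mem_graph_opId.2 (rfl : (a : Fock h) = a))
          ((creation (J ψ)).mem_graph b)))
    rw [H _ hab, inner_add_right, inner_htmul, inner_htmul, inner_vacuum_creation, mul_zero,
      add_zero]
  have hΩ := finiteParticle_le_creation (J ψ) (vacuum_mem_finiteParticle (h := h))
  -- The choice `b = Ω` shows that `v` lies in the domain of `creation ψ` and identifies the
  -- candidate `u = vacProj h y`.
  have hv : (v, vacProj h y) ∈ (creation ψ).graph := by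
    refine (mem_graph_adjoint (dense_annihilation ψ)).2 fun p hp => ?_
    obtain ⟨a, ha, ha'⟩ := (LinearPMap.mem_graph_iff _).1 hp
    rw [← ha, ← ha', ContinuousLinearMap.adjoint_inner_left, tensorRight_apply,
      key a ⟨vacuum h, hΩ⟩, inner_vacuum_vacuum, mul_one]
  refine ⟨_, ?_, hv⟩
  -- With `u` known, `y` and `u ⊗ Ω` have the same inner products with a dense set of vectors.
  refine dense_range_finIncl.eq_of_inner_left ℂ ?_
  rintro _ ⟨z, rfl⟩
  induction z using TensorProduct.induction_on with
  | zero => simp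
  | add z z' h1 h2 => rw [map_add, inner_add_right, inner_add_right, h1, h2]
  | tmul a b =>
    have ha := finiteParticle_le_annihilation ψ a.2
    rw [tensorIncl_tmul, key ⟨a, ha⟩ ⟨b, finiteParticle_le_creation (J ψ) b.2⟩, inner_htmul,
      (mem_graph_adjoint (dense_annihilation ψ)).1 hv _ ((annihilation ψ).mem_graph ⟨a, ha⟩)]

/-- Each starred letter returns a vector of the form `u ⊗ Ω`, so the next one can be treated in the
same way. -/
theorem mem_graph_aWord_of_zWord_star (J : h →ₗ⋆[ℂ] h) (ψ : List h) {v : Fock h}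
    {y : HTensor (Fock h) (Fock h)}
    (H : (htmul v (vacuum h), y) ∈ (zWord J (ψ.map .inr)).graph) :
    ∃ u, y = htmul u (vacuum h) ∧ (v, u) ∈ (aWord (ψ.map .inr)).graph := by
  induction ψ generalizing y with
  | nil => exact ⟨v, (mem_graph_opId.1 H).symm, mem_graph_opId.2 rfl⟩
  | cons a ψ ih =>
    rw [List.map_cons, zWord_cons, mem_graph_opComp, zLetter_inr] at H
    obtain ⟨z, hz, hy⟩ := H
    obtain ⟨u, rfl, hu⟩ := ih hz
    obtain ⟨u', rfl, hu'⟩ := mem_graph_creation_of_htmul_vacuum J a hy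
    refine ⟨u', rfl, ?_⟩
    rw [List.map_cons, aWord_cons, mem_graph_opComp, aLetter_inr]
    exact ⟨u, hu, hu'⟩

/-- Unstarred letters destroy the form `u ⊗ Ω`, so from there on only the image under `vacProj` is
followed. -/
theorem vacProj_mem_graph_aWord (J : h →ₗ⋆[ℂ] h) (φ ψ : List h) {v : Fock h}
    {y : HTensor (Fock h) (Fock h)}
    (H : (htmul v (vacuum h), y) ∈ (zWord J (φ.map .inl ++ ψ.map .inr)).graph) :
    (v, vacProj h y) ∈ (aWord (φ.map .inl ++ ψ.map .inr)).graph := by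
  induction φ generalizing y with
  | nil =>
    obtain ⟨u, rfl, hu⟩ := mem_graph_aWord_of_zWord_star J ψ H
    rw [vacProj_htmul_vacuum]
    exact hu
  | cons a φ ih =>
    rw [List.map_cons, List.cons_append, zWord_cons, mem_graph_opComp, zLetter_inl] at H
    obtain ⟨z, hz, hy⟩ := H
    rw [List.map_cons, List.cons_append, aWord_cons, mem_graph_opComp, aLetter_inl]
    exact ⟨vacProj h z, ih hz, vacProj_mem_graph_annihilation J a hy⟩

theorem vacExp_zWord_le (J : h →ₗ⋆[ℂ] h) (φ ψ : List h) :
    vacExp (zWord J (φ.map .inl ++ ψ.map .inr)) ≤ aWord (φ.map .inl ++ ψ.map .inr) := by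
  refine LinearPMap.le_of_le_graph ?_
  rintro ⟨v, u⟩ H
  obtain ⟨y, hy, rfl⟩ := mem_graph_vacExp.1 H
  exact vacProj_mem_graph_aWord J φ ψ hy

theorem htmul_vacuum_mem_graph_zWord (J : h →ₗ⋆[ℂ] h) (w : List (h ⊕ h)) {v : Fock h}
    (hv : v ∈ finiteParticle h) :
    (htmul v (vacuum h),
      finIncl h (finWord J w (⟨v, hv⟩ ⊗ₜ ⟨vacuum h, vacuum_mem_finiteParticle⟩))) ∈
        (zWord J w).graph :=
  finIncl_mem_graph_zWord J w (⟨v, hv⟩ ⊗ₜ ⟨vacuum h, vacuum_mem_finiteParticle⟩)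

theorem finiteParticle_le_vacExp_zWord (J : h →ₗ⋆[ℂ] h) (w : List (h ⊕ h)) :
    finiteParticle h ≤ (vacExp (zWord J w)).domain := fun _ hv =>
  mem_domain_of_mem_graph (T := zWord J w) (htmul_vacuum_mem_graph_zWord J w hv)

/-! ### Reordering of words -/

/-- The two factors contribute the commutators `⟪φ, ψ⟫` and `-⟪J ψ, J φ⟫`, which cancel by
antiunitarity of `J`. -/
theorem finZ_mul_finZStar (J : h →ₗ⋆[ℂ] h) (hJ : ∀ φ ψ, ⟪J φ, J ψ⟫_ℂ = ⟪ψ, φ⟫_ℂ) (φ ψ : h) :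
    finZ J φ * finZStar J ψ = finZStar J ψ * finZ J φ := by
  simp only [finZ, finZStar, add_mul, mul_add, ← TensorProduct.map_mul, mul_one, one_mul]
  rw [finAnnihilation_mul_finCreation φ ψ, finAnnihilation_mul_finCreation (J ψ) (J φ), hJ,
    TensorProduct.map_add_left, TensorProduct.map_smul_left, TensorProduct.map_add_right,
    TensorProduct.map_smul_right]
  abel

theorem finZStar_mul_finWord (J : h →ₗ⋆[ℂ] h) (hJ : ∀ φ ψ, ⟪J φ, J ψ⟫_ℂ = ⟪ψ, φ⟫_ℂ) (ψ : h)
    (φ : List h) (w : List (h ⊕ h)) :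
    finZStar J ψ * finWord J (φ.map .inl ++ w) = finWord J (φ.map .inl ++ .inr ψ :: w) := by
  induction φ with
  | nil => rw [List.map_nil, List.nil_append, List.nil_append, finWord_cons]; rfl
  | cons a φ ih =>
    rw [List.map_cons, List.cons_append, List.cons_append, finWord_cons, finWord_cons, ← ih,
      ← mul_assoc, ← mul_assoc]
    congr 1
    exact (finZ_mul_finZStar J hJ a ψ).symm

theorem finWord_orderedWord_sortWord (J : h →ₗ⋆[ℂ] h) (hJ : ∀ φ ψ, ⟪J φ, J ψ⟫_ℂ = ⟪ψ, φ⟫_ℂ)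
    (w : List (h ⊕ h)) : finWord J (orderedWord (sortWord w)) = finWord J w := by
  induction w with
  | nil => rfl
  | cons l w ih =>
    rw [finWord_cons, ← ih]
    cases l with
    | inl φ => exact finWord_cons J (.inl φ) _
    | inr ψ => exact (finZStar_mul_finWord J hJ ψ _ _).symm

/-- The word and its sorted form take the same value at `v ⊗ Ω`, and `vacProj_mem_graph_aWord`
applies to the sorted form. -/
theorem vacExp_zWord_eq (J : h →ₗ⋆[ℂ] h) (hJ : ∀ φ ψ, ⟪J φ, J ψ⟫_ℂ = ⟪ψ, φ⟫_ℂ)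
    (w : List (h ⊕ h)) (v : Fock h) (hv : v ∈ finiteParticle h) :
    ∃ (hv : v ∈ (vacExp (zWord J w)).domain)
      (hv' : v ∈ (aWord (orderedWord (sortWord w))).domain),
      vacExp (zWord J w) ⟨v, hv⟩ = aWord (orderedWord (sortWord w)) ⟨v, hv'⟩ := by
  have h1 := htmul_vacuum_mem_graph_zWord J w hv
  have h2 := htmul_vacuum_mem_graph_zWord J (orderedWord (sortWord w)) hv
  rw [finWord_orderedWord_sortWord J hJ] at h2
  have h3 := vacProj_mem_graph_aWord J _ _ h2
  have h4 := mem_graph_vacExp.2 ⟨_, h1, rfl⟩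
  exact ⟨mem_domain_of_mem_graph h4, mem_domain_of_mem_graph h3,
    (apply_eq_of_mem_graph h4 _).trans (apply_eq_of_mem_graph h3 _).symm⟩

end DoubledFock

/-! ### Series of words, and convergence for the exponential functions. -/

section Functions

/-! ### Linear combinations of words -/

theorem mem_graph_opSeries {E F : Type*} [NormedAddCommGroup E] [InnerProductSpace ℂ E]
    [NormedAddCommGroup F] [InnerProductSpace ℂ F] {ι : Type*} {c : ι → ℂ}
    {T : ι → (E →ₗ.[ℂ] F)} {x : E} {y : F} :
    (x, y) ∈ (opSeries c T).graph ↔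
      (∀ i, c i ≠ 0 → x ∈ (T i).domain) ∧ HasSum (fun i => c i • opExt (T i) x) y := by
  constructor
  · intro H
    obtain ⟨⟨x, hx, hs⟩, rfl, rfl⟩ := (LinearPMap.mem_graph_iff _).1 H
    exact ⟨hx, hs.hasSum⟩
  · rintro ⟨hx, hs⟩
    exact (LinearPMap.mem_graph_iff _).2 ⟨⟨x, hx, hs.summable⟩, rfl, hs.tsum_eq⟩

variable {h : Type u} [NormedAddCommGroup h] [InnerProductSpace ℂ h]

theorem vacExp_zFunction_le (J : h →ₗ⋆[ℂ] h) (c : List h × List h → ℂ) :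
    vacExp (zFunction J c) ≤ antiWick c := by
  refine LinearPMap.le_of_le_graph ?_
  rintro ⟨v, u⟩ H
  obtain ⟨y, hy, rfl⟩ := mem_graph_vacExp.1 H
  obtain ⟨hdom, hsum⟩ := mem_graph_opSeries.1 hy
  have key : ∀ p, c p ≠ 0 →
      (v, vacProj h (opExt (zWord J (orderedWord p)) (htmul v (vacuum h)))) ∈
        (aWord (orderedWord p)).graph := fun p hp =>
    vacProj_mem_graph_aWord J p.1 p.2 (mem_graph_opExt (hdom p hp))
  refine mem_graph_opSeries.2 ⟨fun p hp => mem_domain_of_mem_graph (key p hp), ?_⟩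
  have hsum' := (vacProj h).hasSum hsum
  refine hsum'.congr_fun fun p => ?_
  -- Where the coefficient vanishes, nothing is known about domains and `opExt` may be the default
  -- value `0`; the factor `c p` removes such terms.
  by_cases hp : c p = 0
  · simp [hp]
  · rw [opExt_eq_of_mem_graph (key p hp), map_smul]

theorem mem_vacExp_zFunction (J : h →ₗ⋆[ℂ] h) (c : List h × List h → ℂ) {v : Fock h}
    (hv : v ∈ finiteParticle h)
    (hs : Summable fun p => c p • finIncl h
      (finWord J (orderedWord p) (⟨v, hv⟩ ⊗ₜ ⟨vacuum h, vacuum_mem_finiteParticle⟩))) :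
    v ∈ (vacExp (zFunction J c)).domain := by
  refine (mem_vacExp_domain _ v).2 ⟨fun p _ =>
    mem_domain_of_mem_graph (htmul_vacuum_mem_graph_zWord J (orderedWord p) hv), ?_⟩
  refine hs.congr fun p => ?_
  rw [opExt_eq_of_mem_graph (htmul_vacuum_mem_graph_zWord J (orderedWord p) hv)]

theorem finiteParticle_le_vacExp_of_finite (J : h →ₗ⋆[ℂ] h) (c : List h × List h → ℂ)
    (hc : (Function.support c).Finite) :
    finiteParticle h ≤ (vacExp (zFunction J c)).domain := fun v hv => by
  refine mem_vacExp_zFunction J c hv (summable_of_hasFiniteSupport (hc.subset fun p hp => ?_))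
  rw [Function.mem_support] at hp ⊢
  exact fun h0 => hp (by rw [h0, zero_smul])

/-! ### Norm bounds for words -/

variable (h) in
/-- The span of the `u ⊗ w` with fewer than `K` particles in each factor. -/
def fewTensor (K : ℕ) : Submodule ℂ (FinTensor h) :=
  Submodule.span ℂ {z | ∃ u w : finiteParticle h, (u : Fock h) ∈ fewParticles h K ∧
    (w : Fock h) ∈ fewParticles h K ∧ u ⊗ₜ[ℂ] w = z}

theorem tmul_mem_fewTensor {K : ℕ} {u w : finiteParticle h} (hu : (u : Fock h) ∈ fewParticles h K)
    (hw : (w : Fock h) ∈ fewParticles h K) : u ⊗ₜ[ℂ] w ∈ fewTensor h K :=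
  Submodule.subset_span ⟨u, w, hu, hw, rfl⟩

/-- The bound `K + 1` is deliberately crude: it lets every letter raise the cutoff by one. -/
theorem finAnnihilation_mem (φ : h) {K : ℕ} {u : finiteParticle h}
    (hu : (u : Fock h) ∈ fewParticles h K) :
    (finAnnihilation φ u : Fock h) ∈ fewParticles h (K + 1) := by
  rw [coe_finAnnihilation_eq φ u hu]
  exact fewParticles_mono K.le_succ (cutAnnihilation_mem φ K _)

theorem finCreation_mem (ψ : h) {K : ℕ} {u : finiteParticle h}
    (hu : (u : Fock h) ∈ fewParticles h K) :
    (finCreation ψ u : Fock h) ∈ fewParticles h (K + 1) := by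
  rw [coe_finCreation_eq ψ u hu]
  exact cutCreation_mem ψ K _

theorem map_add_map_mem_fewTensor {K : ℕ} {S T : Module.End ℂ (finiteParticle h)}
    (hS : ∀ u : finiteParticle h, (u : Fock h) ∈ fewParticles h K →
      (S u : Fock h) ∈ fewParticles h (K + 1))
    (hT : ∀ u : finiteParticle h, (u : Fock h) ∈ fewParticles h K →
      (T u : Fock h) ∈ fewParticles h (K + 1))
    {z : FinTensor h} (hz : z ∈ fewTensor h K) :
    (TensorProduct.map S 1 + TensorProduct.map 1 T : Module.End ℂ (FinTensor h)) z ∈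
      fewTensor h (K + 1) := by
  induction hz using Submodule.span_induction with
  | zero => rw [map_zero]; exact Submodule.zero_mem _
  | add z z' _ _ h1 h2 => rw [map_add]; exact Submodule.add_mem _ h1 h2
  | smul a z _ h1 => rw [map_smul]; exact Submodule.smul_mem _ a h1
  | mem z hz =>
    obtain ⟨u, w, hu, hw, rfl⟩ := hz
    have hu' := fewParticles_mono K.le_succ hu
    have hw' := fewParticles_mono K.le_succ hw
    exact Submodule.add_mem _ (tmul_mem_fewTensor (hS u hu) hw') (tmul_mem_fewTensor hu' (hT w hw))

/-- A norm bound on elementary tensors would not extend to their span. An identity with the bounded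
operators `S' ⊗ 1 + 1 ⊗ T'` does, and it yields the bound. -/
theorem norm_map_add_map_le {K : ℕ} {S T : Module.End ℂ (finiteParticle h)}
    {S' T' : Fock h →L[ℂ] Fock h} {a b : ℝ} (ha : ‖S'‖ ≤ a) (hb : ‖T'‖ ≤ b)
    (hS : ∀ u : finiteParticle h, (u : Fock h) ∈ fewParticles h K → (S u : Fock h) = S' u)
    (hT : ∀ u : finiteParticle h, (u : Fock h) ∈ fewParticles h K → (T u : Fock h) = T' u)
    {z : FinTensor h} (hz : z ∈ fewTensor h K) :
    ‖finIncl h ((TensorProduct.map S 1 + TensorProduct.map 1 T : Module.End ℂ (FinTensor h)) z)‖ ≤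
      (a + b) * ‖finIncl h z‖ := by
  set ι : FinTensor h →ₗ[ℂ] Fock h ⊗[ℂ] Fock h :=
    TensorProduct.map (finiteParticle h).subtype (finiteParticle h).subtype with hι
  have hn : ∀ z, ‖finIncl h z‖ = ‖ι z‖ := fun z => (toHTensor (Fock h) (Fock h)).norm_map _
  have key : ι ((TensorProduct.map S 1 + TensorProduct.map 1 T : Module.End ℂ (FinTensor h)) z) =
      S'.rTensor (Fock h) (ι z) + T'.lTensor (Fock h) (ι z) := by
    induction hz using Submodule.span_induction with
    | zero => simp only [map_zero, add_zero]
    | add z z' _ _ h1 h2 => simp only [map_add, h1, h2]; abel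
    | smul a z _ h1 => simp only [map_smul, h1, smul_add]
    | mem z hz =>
      obtain ⟨u, w, hu, hw, rfl⟩ := hz
      rw [LinearMap.add_apply, map_add]
      change (S u : Fock h) ⊗ₜ[ℂ] (w : Fock h) + (u : Fock h) ⊗ₜ[ℂ] (T w : Fock h) =
        S' u ⊗ₜ[ℂ] (w : Fock h) + (u : Fock h) ⊗ₜ[ℂ] T' w
      rw [hS u hu, hT w hw]
  rw [hn, hn, key, add_mul]
  exact (norm_add_le _ _).trans (add_le_add
    (ContinuousLinearMap.le_of_opNorm_le _ ((ContinuousLinearMap.norm_rTensor_le _ _).trans ha) _)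
    (ContinuousLinearMap.le_of_opNorm_le _ ((ContinuousLinearMap.norm_lTensor_le _ _).trans hb) _))

theorem norm_cutCreation_le (ψ : h) (K : ℕ) : ‖cutCreation ψ K‖ ≤ √K * ‖ψ‖ := by
  have : cutCreation ψ K = ContinuousLinearMap.adjoint (cutAnnihilation ψ K) :=
    (ContinuousLinearMap.eq_adjoint_iff _ _).2 (inner_cutCreation ψ K)
  rw [this, LinearIsometryEquiv.norm_map]
  exact norm_cutAnnihilation_le ψ K

theorem finLetter_mem_fewTensor (J : h →ₗ⋆[ℂ] h) (l : h ⊕ h) {K : ℕ} {z : FinTensor h}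
    (hz : z ∈ fewTensor h K) : finLetter J l z ∈ fewTensor h (K + 1) :=
  match l with
  | .inl φ => map_add_map_mem_fewTensor (fun _ => finAnnihilation_mem φ)
      (fun _ => finCreation_mem (J φ)) hz
  | .inr ψ => map_add_map_mem_fewTensor (fun _ => finCreation_mem ψ)
      (fun _ => finAnnihilation_mem (J ψ)) hz

theorem norm_finZ_le (J : h →ₗ⋆[ℂ] h) (φ : h) {K : ℕ} {z : FinTensor h}
    (hz : z ∈ fewTensor h K) :
    ‖finIncl h (finZ J φ z)‖ ≤ (√K * ‖φ‖ + √K * ‖J φ‖) * ‖finIncl h z‖ :=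
  norm_map_add_map_le (norm_cutAnnihilation_le φ K) (norm_cutCreation_le (J φ) K)
    (coe_finAnnihilation_eq φ) (coe_finCreation_eq (J φ)) hz

theorem norm_finZStar_le (J : h →ₗ⋆[ℂ] h) (ψ : h) {K : ℕ} {z : FinTensor h}
    (hz : z ∈ fewTensor h K) :
    ‖finIncl h (finZStar J ψ z)‖ ≤ (√K * ‖ψ‖ + √K * ‖J ψ‖) * ‖finIncl h z‖ :=
  norm_map_add_map_le (norm_cutCreation_le ψ K) (norm_cutAnnihilation_le (J ψ) K)
    (coe_finCreation_eq ψ) (coe_finAnnihilation_eq (J ψ)) hz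

theorem norm_finLetter_le (J : h →ₗ⋆[ℂ] h) {φ : h} {l : h ⊕ h} (hl : l = .inl φ ∨ l = .inr φ)
    {K : ℕ} {z : FinTensor h} (hz : z ∈ fewTensor h K) :
    ‖finIncl h (finLetter J l z)‖ ≤ √K * (‖φ‖ + ‖J φ‖) * ‖finIncl h z‖ := by
  rw [mul_add]
  rcases hl with rfl | rfl
  · exact norm_finZ_le J φ hz
  · exact norm_finZStar_le J φ hz

theorem finWord_mem_fewTensor (J : h →ₗ⋆[ℂ] h) (w : List (h ⊕ h)) {K : ℕ} {z : FinTensor h}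
    (hz : z ∈ fewTensor h K) : finWord J w z ∈ fewTensor h (K + w.length) := by
  induction w with
  | nil => exact hz
  | cons l w ih => rw [finWord_cons]; exact finLetter_mem_fewTensor J l ih

/-- A letter applied after `l` others costs at most `√(K + l) * (‖φ‖ + ‖J φ‖)`, and these roots
multiply up to at most the root of a factorial. -/
theorem norm_finWord_le (J : h →ₗ⋆[ℂ] h) {φ : h} {w : List (h ⊕ h)}
    (hw : ∀ l ∈ w, l = .inl φ ∨ l = .inr φ) {K : ℕ} {z : FinTensor h} (hz : z ∈ fewTensor h K) :
    ‖finIncl h (finWord J w z)‖ ≤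
      (‖φ‖ + ‖J φ‖) ^ w.length * √((K + w.length).factorial) * ‖finIncl h z‖ := by
  induction w with
  | nil =>
    have h1 : (1 : ℝ) ≤ √(K.factorial) :=
      Real.one_le_sqrt.2 (by exact_mod_cast Nat.one_le_iff_ne_zero.2 K.factorial_ne_zero)
    simpa [finWord] using le_mul_of_one_le_left (norm_nonneg (finIncl h z)) h1
  | cons l w ih =>
    have ih := ih fun l hl => hw l (List.mem_cons_of_mem _ hl)
    have h1 := norm_finLetter_le J (hw l List.mem_cons_self) (finWord_mem_fewTensor J w hz)
    rw [finWord_cons, Module.End.mul_apply]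
    refine h1.trans ((mul_le_mul_of_nonneg_left ih (by positivity)).trans ?_)
    have h2 : √((K + w.length : ℕ) : ℝ) * √((K + w.length).factorial) ≤
        √((K + (l :: w).length).factorial) := by
      rw [← Real.sqrt_mul (Nat.cast_nonneg _)]
      refine Real.sqrt_le_sqrt ?_
      rw [List.length_cons, ← add_assoc, Nat.factorial_succ]
      push_cast
      exact mul_le_mul_of_nonneg_right (by linarith) (by positivity)
    calc √((K + w.length : ℕ) : ℝ) * (‖φ‖ + ‖J φ‖) *
          ((‖φ‖ + ‖J φ‖) ^ w.length * √((K + w.length).factorial) * ‖finIncl h z‖)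
        = (‖φ‖ + ‖J φ‖) ^ (w.length + 1) *
          (√((K + w.length : ℕ) : ℝ) * √((K + w.length).factorial)) * ‖finIncl h z‖ := by ring
      _ ≤ _ := by rw [List.length_cons]; gcongr; exact h2

/-! ### The exponential functions -/

theorem factorial_add_le (a b : ℕ) :
    (a + b).factorial ≤ 2 ^ (a + b) * (a.factorial * b.factorial) := by
  rw [← Nat.add_choose_mul_factorial_mul_factorial, mul_assoc]
  exact Nat.mul_le_mul_right _ (Nat.choose_le_two_pow _ _)

/-- The term is the product of `(√2 * x) ^ n / √(n!)` and `(1 / √2) ^ n`. It is bounded by the sum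
of their squares, an exponential plus a geometric term. -/
theorem summable_pow_div_sqrt_factorial {x : ℝ} (hx : 0 ≤ x) :
    Summable fun n : ℕ => x ^ n / √(n.factorial) := by
  have h1 := Real.summable_pow_div_factorial (2 * x ^ 2)
  have h2 : Summable fun n : ℕ => (1 / 2 : ℝ) ^ n := summable_geometric_two
  refine Summable.of_nonneg_of_le (fun n => by positivity) (fun n => ?_) (h1.add h2)
  have hf : (0 : ℝ) < n.factorial := by exact_mod_cast n.factorial_pos
  set s := √(n.factorial : ℝ) with hs
  have hs0 : 0 < s := Real.sqrt_pos.2 hf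
  have hss : s ^ 2 = n.factorial := Real.sq_sqrt hf.le
  set t := √(2 : ℝ) with ht
  have ht0 : 0 < t := by positivity
  have htt : t ^ 2 = 2 := Real.sq_sqrt (by norm_num)
  have e1 : (2 * x ^ 2) ^ n / (n.factorial : ℝ) = ((t * x) ^ n / s) ^ 2 := by
    rw [div_pow, hss, ← pow_mul, mul_comm n 2, pow_mul, mul_pow t, htt]
  have e2 : (1 / 2 : ℝ) ^ n = ((1 / t) ^ n) ^ 2 := by
    rw [← pow_mul, mul_comm n 2, pow_mul, div_pow 1 t, htt, one_pow]
  have e3 : x ^ n / s = ((t * x) ^ n / s) * (1 / t) ^ n := by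
    rw [div_mul_eq_mul_div, ← mul_pow]
    congr 2
    field_simp
  rw [e1, e2, e3]
  nlinarith [sq_nonneg ((t * x) ^ n / s - (1 / t) ^ n), sq_nonneg ((t * x) ^ n / s),
    sq_nonneg ((1 / t) ^ n)]

theorem sqrt_factorial_add_le (K n m : ℕ) :
    √((K + (n + m)).factorial) ≤
      √(2 ^ K * K.factorial) * (2 ^ n * √(n.factorial)) * (2 ^ m * √(m.factorial)) := by
  have h1 : (K + (n + m)).factorial ≤
      2 ^ K * K.factorial * ((2 ^ n) ^ 2 * n.factorial) * ((2 ^ m) ^ 2 * m.factorial) :=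
    calc (K + (n + m)).factorial
        ≤ 2 ^ (K + (n + m)) * (K.factorial * (n + m).factorial) := factorial_add_le K (n + m)
      _ ≤ 2 ^ (K + (n + m)) * (K.factorial * (2 ^ (n + m) * (n.factorial * m.factorial))) := by
        gcongr
        exact factorial_add_le n m
      _ = _ := by ring
  have h2 : ((K + (n + m)).factorial : ℝ) ≤
      2 ^ K * K.factorial * ((2 ^ n) ^ 2 * n.factorial) * ((2 ^ m) ^ 2 * m.factorial) := by
    exact_mod_cast h1
  refine (Real.sqrt_le_sqrt h2).trans_eq ?_
  rw [Real.sqrt_mul (by positivity), Real.sqrt_mul (by positivity),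
    Real.sqrt_mul (by positivity) (n.factorial : ℝ), Real.sqrt_mul (by positivity) (m.factorial : ℝ),
    Real.sqrt_sq (by positivity), Real.sqrt_sq (by positivity)]

theorem expCoeff_replicate {h : Type u} (φ : h) (n m : ℕ) :
    expCoeff φ (List.replicate n φ, List.replicate m φ) =
      (-1) ^ n / ((n.factorial : ℂ) * (m.factorial : ℂ)) := by
  rw [expCoeff, if_pos ⟨fun x hx => List.eq_of_mem_replicate hx,
    fun x hx => List.eq_of_mem_replicate hx⟩]
  simp

/-- The coefficients live on pairs of constant lists, hence on `ℕ × ℕ`. There `√((K + n + m)!)`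
splits up to powers of `2` into `√(n!) * √(m!)`, which leaves a product of two convergent series in
`2 * C`. -/
theorem summable_expCoeff_smul (J : h →ₗ⋆[ℂ] h) (φ : h) {K : ℕ} {z : FinTensor h}
    (hz : z ∈ fewTensor h K) :
    Summable fun p => expCoeff φ p • finIncl h (finWord J (orderedWord p) z) := by
  let i : ℕ × ℕ → List h × List h := fun q => (List.replicate q.1 φ, List.replicate q.2 φ)
  have hi : Function.Injective i := fun q q' H => by
    have h1 := congrArg (fun p => p.1.length) H
    have h2 := congrArg (fun p => p.2.length) H
    simp only [i, List.length_replicate] at h1 h2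
    exact Prod.ext h1 h2
  refine (hi.summable_iff fun p hp => ?_).1 ?_
  · rw [expCoeff, if_neg, zero_smul]
    rintro ⟨h1, h2⟩
    exact hp ⟨(p.1.length, p.2.length), Prod.ext (List.eq_replicate_of_mem h1).symm
      (List.eq_replicate_of_mem h2).symm⟩
  set C := ‖φ‖ + ‖J φ‖ with hC
  have hC0 : 0 ≤ C := by positivity
  have hs := summable_pow_div_sqrt_factorial (x := 2 * C) (by positivity)
  have hs2 := (hs.mul_of_nonneg hs (fun n => by positivity) (fun n => by positivity)).mul_left
    (√(2 ^ K * K.factorial) * ‖finIncl h z‖)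
  refine Summable.of_norm_bounded hs2 fun q => ?_
  obtain ⟨n, m⟩ := q
  have hlen : (orderedWord (i (n, m))).length = n + m := by simp [orderedWord, i]
  have hw : ∀ l ∈ orderedWord (i (n, m)), l = .inl φ ∨ l = .inr φ := fun l hl => by
    simp only [orderedWord, i, List.map_replicate, List.mem_append, List.mem_replicate] at hl
    exact hl.imp And.right And.right
  have hb := norm_finWord_le J hw hz
  rw [hlen] at hb
  have hn : (0 : ℝ) < n.factorial := by exact_mod_cast n.factorial_pos
  have hm : (0 : ℝ) < m.factorial := by exact_mod_cast m.factorial_pos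
  have hcoeff : ‖expCoeff φ (i (n, m))‖ = 1 / ((n.factorial : ℝ) * m.factorial) := by
    rw [expCoeff_replicate]
    simp
  rw [Function.comp_apply, norm_smul, hcoeff]
  calc 1 / ((n.factorial : ℝ) * m.factorial) * ‖finIncl h (finWord J (orderedWord (i (n, m))) z)‖
      ≤ 1 / ((n.factorial : ℝ) * m.factorial) * (C ^ (n + m) *
        (√(2 ^ K * K.factorial) * (2 ^ n * √(n.factorial)) * (2 ^ m * √(m.factorial))) *
          ‖finIncl h z‖) := by
        refine mul_le_mul_of_nonneg_left (hb.trans ?_) (by positivity)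
        gcongr
        exact sqrt_factorial_add_le K n m
    _ = √(2 ^ K * K.factorial) * ‖finIncl h z‖ *
        ((2 * C) ^ n / √(n.factorial) * ((2 * C) ^ m / √(m.factorial))) := by
        have en : √(n.factorial : ℝ) / n.factorial = 1 / √(n.factorial) := by
          rw [Real.sqrt_div_self, one_div]
        have em : √(m.factorial : ℝ) / m.factorial = 1 / √(m.factorial) := by
          rw [Real.sqrt_div_self, one_div]
        rw [div_eq_mul_one_div ((2 * C) ^ n), div_eq_mul_one_div ((2 * C) ^ m), ← en, ← em,
          mul_pow, mul_pow, pow_add]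
        ring

theorem finiteParticle_le_vacExp_exp (J : h →ₗ⋆[ℂ] h) (φ : h) :
    finiteParticle h ≤ (vacExp (zFunction J (expCoeff φ))).domain := fun v hv => by
  obtain ⟨K, hK⟩ := mem_finiteParticle.1 hv
  -- The cutoff `K + 1` has room for the vacuum even when `K = 0`.
  refine mem_vacExp_zFunction J _ hv (summable_expCoeff_smul J φ (K := K + 1) ?_)
  exact tmul_mem_fewTensor (fewParticles_mono K.le_succ hK)
    (fewParticles_mono (by omega) vacuum_mem)

end Functions

end BoseFock

end

theorem mainTheorem1 {h : Type*} [NormedAddCommGroup h] [InnerProductSpace ℂ h] [CompleteSpace h]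
    [TopologicalSpace.SeparableSpace h] (J : h →ₗ⋆[ℂ] h) (hJ : ∀ φ, J (J φ) = φ)
    (hJ' : ∀ φ ψ, inner ℂ (J φ) (J ψ) = inner ℂ ψ φ) :
    -- monomials `Z(φ₁) ⋯ Z(φₙ) Z(ψ₁)* ⋯ Z(ψₘ)*`
    (∀ φ ψ : List h,
      BoseFock.vacExp (BoseFock.zWord J (φ.map .inl ++ ψ.map .inr)) ≤
        BoseFock.aWord (φ.map .inl ++ ψ.map .inr) ∧
      BoseFock.finiteParticle h ≤
        (BoseFock.vacExp (BoseFock.zWord J (φ.map .inl ++ ψ.map .inr))).domain) ∧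
    -- monomials in any order of the commuting fields
    (∀ w : List (h ⊕ h), ∀ v ∈ BoseFock.finiteParticle h,
      ∃ (hv : v ∈ (BoseFock.vacExp (BoseFock.zWord J w)).domain)
        (hv' : v ∈ (BoseFock.aWord (BoseFock.orderedWord (BoseFock.sortWord w))).domain),
        BoseFock.vacExp (BoseFock.zWord J w) ⟨v, hv⟩ =
          BoseFock.aWord (BoseFock.orderedWord (BoseFock.sortWord w)) ⟨v, hv'⟩) ∧
    -- functions of the commuting fields
    (∀ c : List h × List h → ℂ,
      BoseFock.vacExp (BoseFock.zFunction J c) ≤ BoseFock.antiWick c) ∧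
    (∀ c : List h × List h → ℂ, (Function.support c).Finite →
      BoseFock.finiteParticle h ≤ (BoseFock.vacExp (BoseFock.zFunction J c)).domain) ∧
    (∀ φ : h, BoseFock.finiteParticle h ≤
      (BoseFock.vacExp (BoseFock.zFunction J (BoseFock.expCoeff φ))).domain) := by
  refine ⟨fun φ ψ => ⟨BoseFock.vacExp_zWord_le J φ ψ, BoseFock.finiteParticle_le_vacExp_zWord J _⟩,
    BoseFock.vacExp_zWord_eq J hJ', BoseFock.vacExp_zFunction_le J,
    BoseFock.finiteParticle_le_vacExp_of_finite J, BoseFock.finiteParticle_le_vacExp_exp J⟩
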